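/- Let $G$ be a group, $d\ge 0$ an integer and $u$ a representation of $G$ by unitary operators on $\mathbb C^d$. On a system of $n$ identical sites, with Hilbert space $(\mathbb C^d)^{\otimes n}$, let $G$ act by $U(g)=u(g)^{\otimes n}$. An operator is $k$-local if it acts non-trivially on at most $k$ sites, i.e. it is of the form $B\otimes I$ with $B$ an operator on at most $k$ of the sites; it is $G$-invariant if it commutes with $U(g)$ for all $g\in G$. For $0\le k\le n$ define: - $\mathcal V^G$, the group of all $G$-invariant unitaries on $(\mathbb C^d)^{\otimes n}$, and $\mathcal V^G_k$, the subgroup generated by the $k$-local $G$-invariant unitaries; $\dim$ of such a group denotes its dimension as a manifold, i.e. the real dimension of its tangent space at the identity (spanned by the initial velocities of smooth curves that start at the identity and stay in the group); - $\mathfrak h_k$, the real Lie algebra generated by the $k$-local $G$-invariant skew-Hermitian operators on $(\mathbb C^d)^{\otimes n}$; - $\mathrm{Irreps}_G(l)$, the set of equivalence classes of irreducible representations of $G$ that appear in $u^{\otimes l}$, for every integer $l\ge 0$; - for an operator $A$ on $(\mathbb C^d)^{\otimes n}$, its charge vector $|\chi_A\rangle=\big(\mathrm{Tr}(\Pi_\mu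 A)\big)_{\mu\in \mathrm{Irreps}_G(n)}$, where $\Pi_\mu$ is the orthogonal projector onto the isotypic component of $\mu$ in $(\mathbb C^d)^{\otimes n}$; - $\mathcal S_k=\{|\chi_A\rangle : iA\in\mathfrak h_k\}$, a real vector space. Then the following holds. 1. For every group $G$, every such $u$ and all integers $0\le k\le n$, $$\mathcal S_k=\{|\chi_H\rangle : H=H^\dagger,\ e^{-iHt}\in\mathcal V^G_k\ \text{for all } t\in\mathbb R\},$$ $$\dim\mathfrak h_n-\dim\mathfrak h_k\ \ge\ \dim\mathcal S_n-\dim\mathcal S_k\ \ge\ |\mathrm{Irreps}_G(n)|-|\mathrm{Irreps}_G(k)|,$$ $$\dim\mathcal V^G-\dim\mathcal V^G_k\ \ge\ |\mathrm{Irreps}_G(n)|-|\mathrm{Irreps}_G(k)|.$$ 2. If $G$ is a connected (finite-dimensional, real) Lie group and $u$ is continuous, then for all integers $1\le k\le l\le n$, $$\dim\mathfrak h_l-\dim\mathfrak h_k\ \ge\ \dim\mathcal S_l-\dim\mathcal S_k\ =\ |\mathrm{Irreps}_G(l)|-|\mathrm{Irreps}_G(k)|,$$ $$\dim\mathcal V^G_l-\dim\mathcal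 V^G_k\ \ge\ |\mathrm{Irreps}_G(l)|-|\mathrm{Irreps}_G(k)|.$$ 3. If $G=\mathrm U(1)$ or $G=\mathrm{SU}(2)$, and $u$ is continuous and not all operators $u(g)$ are scalar multiples of the identity, then $|\mathrm{Irreps}_G(n)|\to\infty$ as $n\to\infty$, and no fixed $k$ gives universality: for every $k$ there is an $N$ such that $\mathcal V^G_k\ne\mathcal V^G$ on $n$ sites, for all $n\ge N$. -/

import Mathlib

open scoped Matrix ContDiff Manifold

attribute [local instance] LieRing.ofAssociativeRing

noncomputable section

namespace LSQC

/-! ### Sites, locality, and the tensor-power representation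

The Hilbert space of `n` sites, each isomorphic to `ℂ^d`, is `(ℂ^d)^{⊗ n}`. It is described in the
product basis, which is indexed by the configurations `Fin n → Fin d`. -/

/-- Configurations of `n` sites: the index set of the product basis of `(ℂ^d)^{⊗ n}`. -/
abbrev Conf (d n : ℕ) : Type := Fin n → Fin d

/-- Operators on `(ℂ^d)^{⊗ n}`, as matrices in the product basis. -/
abbrev Op (d n : ℕ) : Type := Matrix (Conf d n) (Conf d n) ℂ

/-- The group of unitary operators on `(ℂ^d)^{⊗ n}`. -/
abbrev UnitaryOp (d n : ℕ) : Type := Matrix.unitaryGroup (Conf d n) ℂ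

/-- `A` acts non-trivially only on the sites in `S`: it is `B ⊗ 1`, with `B` an operator on the
sites in `S` and `1` the identity on all the other sites. -/
def ActsOn {d n : ℕ} (S : Finset (Fin n)) (A : Op d n) : Prop :=
  ∃ B : Matrix (S → Fin d) (S → Fin d) ℂ,
    (∀ x y : Conf d n, (∀ i ∉ S, x i = y i) → A x y = B (fun i => x i) (fun i => y i)) ∧
    (∀ x y : Conf d n, (∃ i ∉ S, x i ≠ y i) → A x y = 0)

/-- `A` is `k`-local: it acts non-trivially on at most `k` sites. -/
def IsLocal {d n : ℕ} (k : ℕ) (A : Op d n) : Prop :=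
  ∃ S : Finset (Fin n), S.card ≤ k ∧ ActsOn S A

/-- The `n`-fold tensor power `M ⊗ ⋯ ⊗ M` of a `d × d` matrix. -/
def tensorPow {d : ℕ} (n : ℕ) (M : Matrix (Fin d) (Fin d) ℂ) : Op d n :=
  Matrix.of fun x y => ∏ i, M (x i) (y i)

theorem tensorPow_one {d : ℕ} (n : ℕ) : tensorPow n (1 : Matrix (Fin d) (Fin d) ℂ) = 1 := by
  ext x y
  by_cases h : x = y
  · subst h; simp [tensorPow]
  · obtain ⟨i, hi⟩ := Function.ne_iff.mp h
    simp only [tensorPow, Matrix.of_apply, Matrix.one_apply_ne h]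
    exact Finset.prod_eq_zero (Finset.mem_univ i) (Matrix.one_apply_ne hi)

theorem tensorPow_mul {d : ℕ} (n : ℕ) (M N : Matrix (Fin d) (Fin d) ℂ) :
    tensorPow n (M * N) = tensorPow n M * tensorPow n N := by
  ext x y
  simp only [tensorPow, Matrix.of_apply, Matrix.mul_apply, Fintype.prod_sum,
    Finset.prod_mul_distrib]

theorem tensorPow_star {d : ℕ} (n : ℕ) (M : Matrix (Fin d) (Fin d) ℂ) :
    tensorPow n (star M) = star (tensorPow n M) := by
  ext x y
  simp [tensorPow, Matrix.star_apply]

/-- The unitary representation `U(g) = u(g)^{⊗ n}` of `G` on `n` identical sites. -/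
def tensorRep {G : Type*} [Group G] {d : ℕ} (u : G →* Matrix.unitaryGroup (Fin d) ℂ) (n : ℕ) :
    G →* UnitaryOp d n where
  toFun g := ⟨tensorPow n (u g), by
    have h : (u g : Matrix (Fin d) (Fin d) ℂ) * star (u g : Matrix (Fin d) (Fin d) ℂ) = 1 :=
      Matrix.mem_unitaryGroup_iff.mp (u g).2
    rw [Matrix.mem_unitaryGroup_iff, ← tensorPow_star, ← tensorPow_mul, h, tensorPow_one]⟩
  map_one' := Subtype.ext (by simp [tensorPow_one])
  map_mul' g h := Subtype.ext (by simp [tensorPow_mul])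

section
variable {G : Type*} [Group G] {d : ℕ} (u : G →* Matrix.unitaryGroup (Fin d) ℂ)

/-- `A` is `G`-invariant: `[A, u(g)^{⊗ n}] = 0` for all `g`. -/
def IsInvariant {n : ℕ} (A : Op d n) : Prop :=
  ∀ g : G, A * (tensorRep u n g : Op d n) = (tensorRep u n g : Op d n) * A

/-! ### Symmetric unitaries and Lie algebras -/

/-- `𝒱^G`: the group of all `G`-invariant unitaries on `n` sites. -/
def symmetricUnitaries (n : ℕ) : Subgroup (UnitaryOp d n) :=
  Subgroup.centralizer (Set.range (tensorRep u n))

/-- `𝒱_k^G`: the group generated by the `k`-local `G`-invariant unitaries on `n` sites. -/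
def localSymmetricUnitaries (n k : ℕ) : Subgroup (UnitaryOp d n) :=
  Subgroup.closure {V | IsLocal k (V : Op d n) ∧ IsInvariant u (V : Op d n)}

/-- `𝔥_k`: the real Lie algebra generated by the `k`-local, skew-Hermitian, `G`-invariant operators
on `n` sites. -/
def localLieAlgebra (n k : ℕ) : LieSubalgebra ℝ (Op d n) :=
  LieSubalgebra.lieSpan ℝ (Op d n) {A | IsLocal k A ∧ A + Aᴴ = 0 ∧ IsInvariant u A}

end

/-- The tangent vectors at the identity of a group `V` of unitaries: the initial velocities of the
smooth curves of operators that start at the identity and run inside `V`. -/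
def tangentVectors {d n : ℕ} (V : Subgroup (UnitaryOp d n)) : Set (Op d n) :=
  {X | ∃ γ : ℝ → UnitaryOp d n, (∀ t, γ t ∈ V) ∧ γ 0 = 1 ∧
    (∀ x y, ContDiff ℝ ∞ fun t => (γ t : Op d n) x y) ∧
    ∀ x y, HasDerivAt (fun t => (γ t : Op d n) x y) (X x y) 0}

/-- The dimension, as a manifold, of a Lie group `V` of unitaries: the real dimension of its tangent
space at the identity. -/
def groupDim {d n : ℕ} (V : Subgroup (UnitaryOp d n)) : ℕ :=
  Module.finrank ℝ (Submodule.span ℝ (tangentVectors V))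

/-! ### Irreducible representations and charge vectors -/

section
variable {G : Type*} [Group G] {d : ℕ} (u : G →* Matrix.unitaryGroup (Fin d) ℂ)

/-- The representation `g ↦ u(g)^{⊗ n}` acting on the Hilbert space of `n` sites. -/
def siteRep (n : ℕ) : Representation ℂ G (EuclideanSpace ℂ (Conf d n)) where
  toFun g := (Matrix.toEuclideanCLM (n := Conf d n) (𝕜 := ℂ) (tensorRep u n g)).toLinearMap
  map_one' := by ext; simp
  map_mul' g h := by ext; simp

/-- The irreducible subrepresentations of `u^{⊗ n}`. -/
abbrev IrreducibleSub (n : ℕ) : Type :=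
  {σ : Subrepresentation (siteRep u n) // σ.toRepresentation.IsIrreducible}

/-- Equivalence of irreducible subrepresentations. -/
instance irrepSetoid (n : ℕ) : Setoid (IrreducibleSub u n) where
  r σ τ := Nonempty (σ.1.toRepresentation.Equiv τ.1.toRepresentation)
  iseqv := ⟨fun _ => ⟨.refl _⟩, fun ⟨e⟩ => ⟨e.symm⟩, fun ⟨e⟩ ⟨f⟩ => ⟨e.trans f⟩⟩

/-- `Irreps_G(n)`: the equivalence classes of irreducible representations of `G` that appear in
`u^{⊗ n}`. -/
abbrev Irreps (n : ℕ) : Type := Quotient (irrepSetoid u n)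

/-- `|Irreps_G(n)|`. -/
def numIrreps (n : ℕ) : ℕ := Nat.card (Irreps u n)

/-- The isotypic component of `μ`: the sum of all subrepresentations of class `μ`. -/
def isotypic (n : ℕ) (μ : Irreps u n) : Submodule ℂ (EuclideanSpace ℂ (Conf d n)) :=
  ⨆ σ : {σ : IrreducibleSub u n // (⟦σ⟧ : Irreps u n) = μ}, σ.1.1.toSubmodule

/-- The charge vector `|χ_A⟩ = ∑_μ Tr(Π_μ A) |μ⟩` of an operator `A`, where `Π_μ` is the orthogonal
projector to the isotypic component of `μ`; it is linear in `A`. -/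
def chargeVector (n : ℕ) : Op d n →ₗ[ℂ] (Irreps u n → ℂ) :=
  LinearMap.pi fun μ =>
    LinearMap.trace ℂ (EuclideanSpace ℂ (Conf d n)) ∘ₗ
      LinearMap.mulLeft ℂ (isotypic u n μ).starProjection.toLinearMap ∘ₗ
        Matrix.toEuclideanLin.toLinearMap

/-- `𝒮_k = {|χ_A⟩ : i A ∈ 𝔥_k}`, a real vector space. -/
def chargeSpace (n k : ℕ) : Submodule ℝ (Irreps u n → ℂ) :=
  ((localLieAlgebra u n k).toSubmodule.comap
    ((Complex.I • (LinearMap.id : Op d n →ₗ[ℂ] Op d n)).restrictScalars ℝ)).map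
      ((chargeVector u n).restrictScalars ℝ)

end

end LSQC

end

/-!
Locality obstructs universality through the abelianised algebra of invariant operators.

A linear functional on operators which is a trace on the invariant operators is, on these, a linear
combination of the charges `A ↦ Tr (Π_μ A)` (`IsTracial.exists_weights`): by Schur's lemma such a
functional is determined by its values on the projectors onto irreducible subrepresentations, and
these values depend on the equivalence class only. The charges themselves are tracial, so they
vanish on commutators, and they are unchanged when the sites are permuted. Hence `𝒮_k` is spanned by
the charge vectors of the operators `A ⊗ 1`, with `A` invariant and Hermitian on the first `k` sites
(`chargeSpace_eq_localCharges`). The charges of `A ⊗ 1` are tracial in `A`, hence functions of the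
charges of `A`, so `dim 𝒮_k ≤ |Irreps_G(k)|` (`finrank_localCharges_le`), with equality for `k = n`.
As `𝒮_k` is a linear image of `𝔥_k`, rank-nullity turns bounds on `𝒮` into bounds on `𝔥`.

For the groups, the logarithms of Lie theory are replaced by the determinants of a unitary on the
isotypic components. A `k`-local invariant unitary is `e^{iH}` with `H` local and invariant, so the
sector determinants of every element of `𝒱_k` are the entries of `e^{is}` for some `s ∈ 𝒮_k`
(`exists_sectorDet_eq`). Along a smooth curve in `𝒱_k`, their logarithms stay in `i 𝒮_k` up to a
countable group, hence in `i 𝒮_k` near the start, and so the charges of the initial velocity lie in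
`𝒮_k` (`chargeMap_mem_of_mem_tangentVectors`). Thus the tangent space of `𝒱_k` has the same image
`𝒮_k` as `𝔥_k` (`map_span_tangentVectors_eq`).

For a connected group and `k ≥ 1`, `dim 𝒮_k = |Irreps_G(k)|` (`finrank_chargeSpace_eq`): if `A ⊗ 1`
has no charges, then `Tr (A U(g)) Tr (U(g)) = 0` for all `g`, where the two traces are taken on the
first `k` sites and on the others. The second factor does not vanish near the identity, and a
matrix coefficient that vanishes near the identity vanishes everywhere, so that `A`, if it is a
combination of the `Π_ν`, is zero, because the `Π_ν` lie in the span of the group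
(`trace_mul_isotypicMat_eq_zero`).

The number of charges grows (`half_lt_numIrreps`): it bounds the dimension of the span of the
functions `Tr (A U(·))` with `A` invariant on `n` sites, and the products of swaps give the
functions `Tr(u)^(n-2j) Tr(u²)^j`. A linear relation between these makes `Tr(u²) / Tr(u)²` locally
constant at the identity, which forces `u` to be scalar (`eq_smul_one_of_trace_sq`). Connectedness
is all that is used of `U(1)` and `SU(2)`.
-/

noncomputable section

namespace LSQC

section

variable {G : Type*} [Group G] {d : ℕ} (u : G →* Matrix.unitaryGroup (Fin d) ℂ)

/-! ### Invariant operators and orthogonal projections -/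

section Projections
variable {n : ℕ}

/-- A matrix in the product basis as a continuous linear operator on the Hilbert space. -/
abbrev opCLM {d n : ℕ} :
    Op d n ≃⋆ₐ[ℂ] (EuclideanSpace ℂ (Conf d n) →L[ℂ] EuclideanSpace ℂ (Conf d n)) :=
  Matrix.toEuclideanCLM (n := Conf d n) (𝕜 := ℂ)

/-- The matrix of the orthogonal projector onto a subspace `W`. -/
def projMat {d n : ℕ} (W : Submodule ℂ (EuclideanSpace ℂ (Conf d n))) : Op d n :=
  opCLM.symm W.starProjection

variable {W W' : Submodule ℂ (EuclideanSpace ℂ (Conf d n))}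

@[simp] lemma opCLM_projMat : opCLM (projMat W) = W.starProjection := by
  simp [projMat]

lemma opCLM_injective : Function.Injective (opCLM (d := d) (n := n)) :=
  EquivLike.injective _

lemma opCLM_ext {A B : Op d n} (h : ∀ v, opCLM A v = opCLM B v) : A = B :=
  opCLM_injective (ContinuousLinearMap.ext h)

lemma siteRep_apply (g : G) (v : EuclideanSpace ℂ (Conf d n)) :
    siteRep u n g v = opCLM (tensorRep u n g : Op d n) v := rfl

lemma opCLM_mul_apply (A B : Op d n) (v : EuclideanSpace ℂ (Conf d n)) :
    opCLM (A * B) v = opCLM A (opCLM B v) := by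
  rw [map_mul]; rfl

lemma inner_opCLM_left (A : Op d n) (v w : EuclideanSpace ℂ (Conf d n)) :
    inner ℂ (opCLM A v) w = inner ℂ v (opCLM Aᴴ w) := by
  rw [← Matrix.star_eq_conjTranspose, map_star, ContinuousLinearMap.star_eq_adjoint,
    ContinuousLinearMap.adjoint_inner_right]

lemma projMat_isHermitian : (projMat W).IsHermitian := by
  apply opCLM_injective
  rw [← Matrix.star_eq_conjTranspose, map_star, opCLM_projMat]
  exact isSelfAdjoint_starProjection W

lemma projMat_mul_self : projMat W * projMat W = projMat W := by
  apply opCLM_injective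
  rw [map_mul, opCLM_projMat]
  exact W.isIdempotentElem_starProjection

lemma projMat_mul_eq_right_iff {A : Op d n} :
    projMat W * A = A ↔ ∀ v, opCLM A v ∈ W := by
  constructor
  · intro h v
    rw [← h, opCLM_mul_apply, opCLM_projMat]
    exact W.starProjection_apply_mem _
  · intro h
    refine opCLM_ext fun v => ?_
    rw [opCLM_mul_apply, opCLM_projMat]
    exact Submodule.starProjection_eq_self_iff.mpr (h v)

lemma projMat_mul_projMat_of_le (h : W ≤ W') : projMat W' * projMat W = projMat W :=
  projMat_mul_eq_right_iff.mpr fun v => by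
    rw [opCLM_projMat]; exact h (W.starProjection_apply_mem v)

lemma projMat_mul_projMat_of_le' (h : W ≤ W') : projMat W * projMat W' = projMat W := by
  have := congrArg Matrix.conjTranspose (projMat_mul_projMat_of_le h)
  rwa [Matrix.conjTranspose_mul, projMat_isHermitian.eq, projMat_isHermitian.eq] at this

lemma projMat_mul_projMat_of_isOrtho (h : W ⟂ W') : projMat W * projMat W' = 0 := by
  refine opCLM_ext fun v => ?_
  rw [opCLM_mul_apply, opCLM_projMat, opCLM_projMat, map_zero]
  exact (Submodule.starProjection_apply_eq_zero_iff W).mpr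
    (h.symm (W'.starProjection_apply_mem v))

lemma projMat_top : projMat (⊤ : Submodule ℂ (EuclideanSpace ℂ (Conf d n))) = 1 :=
  opCLM_injective (by rw [opCLM_projMat, map_one, Submodule.starProjection_top'])

lemma projMat_bot : projMat (⊥ : Submodule ℂ (EuclideanSpace ℂ (Conf d n))) = 0 :=
  opCLM_injective (by rw [opCLM_projMat, map_zero, Submodule.starProjection_bot])

lemma trace_eq_trace_opCLM (A : Op d n) :
    A.trace = LinearMap.trace ℂ _ (opCLM A).toLinearMap := by
  rw [Matrix.coe_toEuclideanCLM_eq_toEuclideanLin, Matrix.toEuclideanLin_eq_toLin_orthonormal,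
    Matrix.trace_toLin_eq]

lemma trace_projMat : (projMat W).trace = Module.finrank ℂ W := by
  rw [trace_eq_trace_opCLM, opCLM_projMat]
  exact LinearMap.IsProj.trace (p := W)
    ⟨fun v => W.starProjection_apply_mem v, fun v hv => Submodule.starProjection_eq_self_iff.mpr hv⟩

/-- If `W` is stable under `A` and `Aᴴ`, then its projector commutes with `A`. -/
lemma projMat_comm_of_stable {A : Op d n} (h : ∀ v ∈ W, opCLM A v ∈ W)
    (h' : ∀ v ∈ W, opCLM Aᴴ v ∈ W) : A * projMat W = projMat W * A := by
  have key : ∀ B : Op d n, (∀ v ∈ W, opCLM B v ∈ W) → projMat W * (B * projMat W) = B * projMat W :=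
    fun B hB => projMat_mul_eq_right_iff.mpr fun v => by
      rw [opCLM_mul_apply, opCLM_projMat]
      exact hB _ (W.starProjection_apply_mem v)
  have h2 := congrArg Matrix.conjTranspose (key _ h')
  simp only [Matrix.conjTranspose_mul, Matrix.conjTranspose_conjTranspose,
    projMat_isHermitian.eq] at h2
  rw [← key A h, ← h2, mul_assoc]

end Projections

section Invariant
variable {u} {n : ℕ} {A B : Op d n}

lemma tensorRep_conjTranspose (g : G) :
    (tensorRep u n g : Op d n)ᴴ = (tensorRep u n g⁻¹ : Op d n) := by
  rw [map_inv]; rfl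

lemma IsInvariant.conjTranspose (h : IsInvariant u A) : IsInvariant u Aᴴ := fun g => by
  have := congrArg Matrix.conjTranspose (h g⁻¹)
  rw [Matrix.conjTranspose_mul, Matrix.conjTranspose_mul, tensorRep_conjTranspose, inv_inv] at this
  exact this.symm

lemma IsInvariant.mul (hA : IsInvariant u A) (hB : IsInvariant u B) : IsInvariant u (A * B) :=
  fun g => by rw [mul_assoc, hB g, ← mul_assoc, hA g, mul_assoc]

lemma IsInvariant.add (hA : IsInvariant u A) (hB : IsInvariant u B) : IsInvariant u (A + B) :=
  fun g => by rw [add_mul, mul_add, hA g, hB g]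

lemma IsInvariant.sub (hA : IsInvariant u A) (hB : IsInvariant u B) : IsInvariant u (A - B) :=
  fun g => by rw [sub_mul, mul_sub, hA g, hB g]

lemma IsInvariant.smul (c : ℂ) (hA : IsInvariant u A) : IsInvariant u (c • A) :=
  fun g => by rw [Matrix.smul_mul, Matrix.mul_smul, hA g]

lemma isInvariant_zero : IsInvariant u (0 : Op d n) := fun g => by simp

lemma isInvariant_one : IsInvariant u (1 : Op d n) := fun g => by simp

lemma isInvariant_sum {ι : Type*} (s : Finset ι) (f : ι → Op d n)
    (h : ∀ i ∈ s, IsInvariant u (f i)) : IsInvariant u (∑ i ∈ s, f i) :=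
  fun g => by rw [Finset.sum_mul, Finset.mul_sum]; exact Finset.sum_congr rfl fun i hi => h i hi g

lemma isInvariant_projMat (σ : Subrepresentation (siteRep u n)) :
    IsInvariant u (projMat σ.toSubmodule) := fun g => by
  refine (projMat_comm_of_stable (fun v hv => σ.apply_mem_toSubmodule g hv) fun v hv => ?_).symm
  rw [tensorRep_conjTranspose]
  exact σ.apply_mem_toSubmodule g⁻¹ hv

lemma IsInvariant.opCLM_siteRep (hA : IsInvariant u A) (g : G) (v) :
    opCLM A (siteRep u n g v) = siteRep u n g (opCLM A v) := by
  rw [siteRep_apply, siteRep_apply, ← opCLM_mul_apply, ← opCLM_mul_apply, hA g]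

end Invariant

/-! ### Schur's lemma for irreducible subrepresentations -/

section Schur
variable {u} {n : ℕ} {A : Op d n}

/-- The orthogonal complement of a subrepresentation. -/
def orthogonalSub (σ : Subrepresentation (siteRep u n)) : Subrepresentation (siteRep u n) where
  toSubmodule := σ.toSubmoduleᗮ
  apply_mem_toSubmodule g v hv := by
    rw [Submodule.mem_orthogonal] at hv ⊢
    intro w hw
    rw [siteRep_apply, ← inner_conj_symm, inner_opCLM_left, inner_conj_symm,
      tensorRep_conjTranspose]
    exact hv _ (σ.apply_mem_toSubmodule g⁻¹ hw)

/-- An invariant operator with values in `τ`, restricted to `σ`, as an intertwining map. -/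
def IsInvariant.intertwining (hA : IsInvariant u A) (σ τ : Subrepresentation (siteRep u n))
    (h : ∀ v, opCLM A v ∈ τ.toSubmodule) :
    σ.toRepresentation.IntertwiningMap τ.toRepresentation where
  toLinearMap := ((opCLM A).toLinearMap ∘ₗ σ.toSubmodule.subtype).codRestrict τ.toSubmodule
    fun v => h _
  isIntertwining' g := by
    ext v : 2
    exact hA.opCLM_siteRep g v

lemma IsInvariant.coe_intertwining_apply (hA : IsInvariant u A)
    (σ τ : Subrepresentation (siteRep u n)) (h : ∀ v, opCLM A v ∈ τ.toSubmodule)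
    (v : σ.toSubmodule) :
    ((hA.intertwining σ τ h v : τ.toSubmodule) : EuclideanSpace ℂ (Conf d n)) = opCLM A v := rfl

/-- An intertwining map between two subrepresentations as an operator: zero on the orthogonal
complement of its domain. -/
def extendIntertwining {σ τ : Subrepresentation (siteRep u n)}
    (f : σ.toRepresentation.IntertwiningMap τ.toRepresentation) : Op d n :=
  opCLM.symm (LinearMap.toContinuousLinearMap (τ.toSubmodule.subtype ∘ₗ f.toLinearMap ∘ₗ
    σ.toSubmodule.orthogonalProjectionOnto.toLinearMap))

lemma opCLM_extendIntertwining {σ τ : Subrepresentation (siteRep u n)}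
    (f : σ.toRepresentation.IntertwiningMap τ.toRepresentation) (v) :
    opCLM (extendIntertwining f) v = f (σ.toSubmodule.orthogonalProjectionOnto v) := by
  simp [extendIntertwining]

lemma isInvariant_extendIntertwining {σ τ : Subrepresentation (siteRep u n)}
    (f : σ.toRepresentation.IntertwiningMap τ.toRepresentation) :
    IsInvariant u (extendIntertwining f) := by
  intro g
  refine opCLM_ext fun v => ?_
  rw [opCLM_mul_apply, opCLM_mul_apply, opCLM_extendIntertwining, opCLM_extendIntertwining]
  have h1 : σ.toSubmodule.orthogonalProjectionOnto (opCLM (tensorRep u n g : Op d n) v) =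
      σ.toRepresentation g (σ.toSubmodule.orthogonalProjectionOnto v) := by
    apply Subtype.ext
    have := (isInvariant_projMat σ).opCLM_siteRep g v
    rw [opCLM_projMat] at this
    exact this
  rw [h1, Representation.IntertwiningMap.isIntertwining]
  rfl

lemma projMat_mul_mul_projMat_eq_zero {σ τ : IrreducibleSub u n} (hA : IsInvariant u A)
    (h : ¬ σ ≈ τ) : projMat τ.1.toSubmodule * A * projMat σ.1.toSubmodule = 0 := by
  have hB := (isInvariant_projMat τ.1).mul hA
  have hmem : ∀ v, opCLM (projMat τ.1.toSubmodule * A) v ∈ τ.1.toSubmodule := fun v => by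
    rw [opCLM_mul_apply, opCLM_projMat]; exact Submodule.starProjection_apply_mem _ _
  have := σ.2
  have := τ.2
  have : IsEmpty (σ.1.toRepresentation.Equiv τ.1.toRepresentation) := not_nonempty_iff.mp h
  have h0 : hB.intertwining σ.1 τ.1 hmem = 0 := Subsingleton.elim _ _
  refine opCLM_ext fun v => ?_
  rw [opCLM_mul_apply, opCLM_projMat, map_zero]
  rw [← hB.coe_intertwining_apply σ.1 τ.1 hmem ⟨_, σ.1.toSubmodule.starProjection_apply_mem v⟩, h0]
  rfl

lemma exists_projMat_mul_mul_projMat_eq_smul (σ : IrreducibleSub u n) (hA : IsInvariant u A) :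
    ∃ c : ℂ, projMat σ.1.toSubmodule * A * projMat σ.1.toSubmodule =
      c • projMat σ.1.toSubmodule := by
  have hB := (isInvariant_projMat σ.1).mul hA
  have hmem : ∀ v, opCLM (projMat σ.1.toSubmodule * A) v ∈ σ.1.toSubmodule := fun v => by
    rw [opCLM_mul_apply, opCLM_projMat]; exact Submodule.starProjection_apply_mem _ _
  have := σ.2
  obtain ⟨c, hc⟩ :=
    (Representation.IsIrreducible.algebraMap_intertwiningMap_bijective_of_isAlgClosed
      (ρ := σ.1.toRepresentation)).2 (hB.intertwining σ.1 σ.1 hmem)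
  refine ⟨c, opCLM_ext fun v => ?_⟩
  rw [opCLM_mul_apply, opCLM_projMat, map_smul]
  rw [← hB.coe_intertwining_apply σ.1 σ.1 hmem ⟨_, σ.1.toSubmodule.starProjection_apply_mem v⟩,
    ← hc, Representation.IntertwiningMap.algebraMap_apply, opCLM_projMat]
  rfl

/-- Every nonzero subrepresentation contains an irreducible one. -/
lemma exists_irreducibleSub_le {τ : Subrepresentation (siteRep u n)} (h : τ ≠ ⊥) :
    ∃ σ : IrreducibleSub u n, σ.1 ≤ τ := by
  have : WellFoundedLT (Subrepresentation (siteRep u n)) :=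
    ⟨(InvImage.wf (fun σ : Subrepresentation (siteRep u n) => σ.toSubmodule)
      (wellFounded_lt (α := Submodule ℂ (EuclideanSpace ℂ (Conf d n)))))⟩
  obtain ⟨a, ha, hle⟩ := (eq_bot_or_exists_atom_le τ).resolve_left h
  refine ⟨⟨a, ?_⟩, hle⟩
  have hbot : a.toSubmodule ≠ ⊥ := fun h => ha.1 (Subrepresentation.toSubmodule_injective h)
  have : Nontrivial a.toSubmodule := Submodule.nontrivial_iff_ne_bot.mpr hbot
  refine { exists_pair_ne := ⟨⊥, ⊤, fun h => ?_⟩, eq_bot_or_eq_top := fun τ => ?_ }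
  · have := congrArg Subrepresentation.toSubmodule h
    exact bot_ne_top (α := Submodule ℂ a.toSubmodule) this
  · let τ' : Subrepresentation (siteRep u n) :=
      { toSubmodule := τ.toSubmodule.map a.toSubmodule.subtype
        apply_mem_toSubmodule := by
          rintro g _ ⟨w, hw, rfl⟩
          exact ⟨_, τ.apply_mem_toSubmodule g hw, rfl⟩ }
    have hτ' : τ' ≤ a := by
      rintro _ ⟨w, hw, rfl⟩
      exact w.2
    rcases ha.le_iff.mp hτ' with h | h
    · left
      apply Subrepresentation.toSubmodule_injective
      have := congrArg Subrepresentation.toSubmodule h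
      exact Submodule.map_injective_of_injective a.toSubmodule.subtype_injective
        (this.trans (Submodule.map_bot _).symm)
    · right
      apply Subrepresentation.toSubmodule_injective
      have : τ.toSubmodule.map a.toSubmodule.subtype = a.toSubmodule :=
        congrArg Subrepresentation.toSubmodule h
      refine eq_top_iff.mpr fun w _ => ?_
      have hw : (w : EuclideanSpace ℂ (Conf d n)) ∈ τ.toSubmodule.map a.toSubmodule.subtype := by
        rw [this]; exact w.2
      obtain ⟨w', hw', h'⟩ := hw
      rwa [← Subtype.ext h']

end Schur

end

section

variable {G : Type*} [Group G] {d : ℕ} {u : G →* Matrix.unitaryGroup (Fin d) ℂ}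

/-! ### Isotypic components -/

section Isotypic
variable {n : ℕ} {A : Op d n}

lemma isOrtho_of_not_equiv {σ τ : IrreducibleSub u n} (h : ¬ σ ≈ τ) :
    τ.1.toSubmodule ⟂ σ.1.toSubmodule := by
  have := projMat_mul_mul_projMat_eq_zero isInvariant_one h
  rw [mul_one] at this
  rw [← Submodule.starProjection_comp_starProjection_eq_zero_iff]
  have := congrArg opCLM this
  rwa [map_mul, map_zero, opCLM_projMat, opCLM_projMat] at this

lemma le_isotypic (σ : IrreducibleSub u n) : σ.1.toSubmodule ≤ isotypic u n ⟦σ⟧ :=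
  le_iSup (fun τ : {τ : IrreducibleSub u n // (⟦τ⟧ : Irreps u n) = ⟦σ⟧} => τ.1.1.toSubmodule)
    ⟨σ, rfl⟩

lemma isotypic_isOrtho_of_ne {μ ν : Irreps u n} (h : μ ≠ ν) :
    isotypic u n μ ⟂ isotypic u n ν := by
  rw [isotypic, isotypic, Submodule.isOrtho_iSup_left]
  intro σ
  rw [Submodule.isOrtho_iSup_right]
  intro τ
  refine isOrtho_of_not_equiv fun hs => h ?_
  rw [← σ.2, ← τ.2]
  exact (Quotient.sound hs).symm

lemma irreducibleSub_ne_bot (σ : IrreducibleSub u n) : σ.1.toSubmodule ≠ ⊥ := by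
  intro h
  have := σ.2
  apply bot_ne_top (α := Subrepresentation σ.1.toRepresentation)
  apply Subrepresentation.toSubmodule_injective
  refine eq_top_iff.mpr fun v _ => ?_
  have hv : (v : EuclideanSpace ℂ (Conf d n)) ∈ (⊥ : Submodule ℂ _) := h ▸ v.2
  have hv0 : v = 0 := Subtype.ext (by simpa using hv)
  rw [hv0]
  exact Submodule.zero_mem _

lemma isotypic_ne_bot (μ : Irreps u n) : isotypic u n μ ≠ ⊥ := by
  obtain ⟨σ, rfl⟩ := Quotient.exists_rep μ
  intro h
  exact irreducibleSub_ne_bot σ (le_bot_iff.mp (h ▸ le_isotypic σ))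

instance : Finite (Irreps u n) := by
  choose v hv hv0 using fun μ : Irreps u n => (Submodule.ne_bot_iff _).mp (isotypic_ne_bot μ)
  have : LinearIndependent ℂ v := linearIndependent_of_ne_zero_of_inner_eq_zero hv0
    fun μ ν h => Submodule.isOrtho_iff_inner_eq.mp (isotypic_isOrtho_of_ne h) _ (hv μ) _ (hv ν)
  exact this.finite

instance : Fintype (Irreps u n) := Fintype.ofFinite _

lemma numIrreps_eq_card : numIrreps u n = Fintype.card (Irreps u n) := Nat.card_eq_fintype_card

variable (u n) in
/-- The isotypic component of `μ` as a subrepresentation. -/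
def isotypicSub (μ : Irreps u n) : Subrepresentation (siteRep u n) where
  toSubmodule := isotypic u n μ
  apply_mem_toSubmodule g := by
    have : isotypic u n μ ≤ (isotypic u n μ).comap (siteRep u n g) :=
      iSup_le fun σ v hv => le_iSup (fun τ : {τ : IrreducibleSub u n // (⟦τ⟧ : Irreps u n) = μ} =>
        τ.1.1.toSubmodule) σ (σ.1.1.apply_mem_toSubmodule g hv)
    exact fun v hv => this hv

variable (u n) in
/-- The matrix of the orthogonal projector `Π_μ` onto the isotypic component of `μ`. -/
def isotypicMat (μ : Irreps u n) : Op d n := projMat (isotypic u n μ)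

lemma isInvariant_isotypicMat (μ : Irreps u n) : IsInvariant u (isotypicMat u n μ) :=
  isInvariant_projMat (isotypicSub u n μ)

lemma iSup_isotypic : ⨆ μ, isotypic u n μ = ⊤ := by
  let τ : Subrepresentation (siteRep u n) :=
    { toSubmodule := ⨆ μ, isotypic u n μ
      apply_mem_toSubmodule := fun g => by
        have : ⨆ μ, isotypic u n μ ≤ (⨆ μ, isotypic u n μ).comap (siteRep u n g) :=
          iSup_le fun μ v hv => le_iSup (isotypic u n) μ
            ((isotypicSub u n μ).apply_mem_toSubmodule g hv)
        exact fun v hv => this hv }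
  by_contra h
  have hne : orthogonalSub τ ≠ ⊥ := fun h0 => h
    ((Submodule.orthogonal_eq_bot_iff).mp (congrArg Subrepresentation.toSubmodule h0))
  obtain ⟨σ, hσ⟩ := exists_irreducibleSub_le hne
  apply irreducibleSub_ne_bot σ
  rw [eq_bot_iff, ← Submodule.inf_orthogonal_eq_bot (⨆ μ, isotypic u n μ)]
  exact le_inf ((le_isotypic σ).trans (le_iSup (isotypic u n) _)) hσ

lemma isotypicMat_mul_of_ne {μ ν : Irreps u n} (h : μ ≠ ν) :
    isotypicMat u n μ * isotypicMat u n ν = 0 :=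
  projMat_mul_projMat_of_isOrtho (isotypic_isOrtho_of_ne h)

lemma isotypicMat_mul_self (μ : Irreps u n) :
    isotypicMat u n μ * isotypicMat u n μ = isotypicMat u n μ := projMat_mul_self

lemma sum_isotypicMat : ∑ μ, isotypicMat u n μ = 1 := by
  refine opCLM_ext fun v => ?_
  have hle : ⨆ μ, isotypic u n μ ≤
      LinearMap.eqLocus (opCLM (∑ μ, isotypicMat u n μ)).toLinearMap LinearMap.id := by
    refine iSup_le fun ν v hv => ?_
    have hv' : opCLM (isotypicMat u n ν) v = v := by
      rw [isotypicMat, opCLM_projMat]; exact Submodule.starProjection_eq_self_iff.mpr hv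
    change opCLM (∑ μ, isotypicMat u n μ) v = v
    have : (∑ μ, isotypicMat u n μ) * isotypicMat u n ν = isotypicMat u n ν := by
      rw [Finset.sum_mul, Finset.sum_eq_single ν (fun μ _ h => isotypicMat_mul_of_ne h) (by simp),
        isotypicMat_mul_self]
    calc opCLM (∑ μ, isotypicMat u n μ) v
        = opCLM ((∑ μ, isotypicMat u n μ) * isotypicMat u n ν) v := by
          rw [opCLM_mul_apply, hv']
      _ = v := by rw [this, hv']
  rw [iSup_isotypic] at hle
  rw [map_one]
  exact hle (Submodule.mem_top (x := v))

lemma isotypicMat_mul_mul_of_ne (hA : IsInvariant u A) {μ ν : Irreps u n} (h : μ ≠ ν) :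
    isotypicMat u n ν * A * isotypicMat u n μ = 0 := by
  have hle : isotypic u n μ ≤ (isotypic u n ν)ᗮ.comap (opCLM A).toLinearMap := by
    refine iSup_le fun σ v hv => ?_
    rw [Submodule.mem_comap, isotypic, ← Submodule.iInf_orthogonal, Submodule.mem_iInf]
    intro τ
    rw [← Submodule.starProjection_apply_eq_zero_iff]
    have h0 := projMat_mul_mul_projMat_eq_zero (σ := σ.1) (τ := τ.1) hA
      fun hs => h (by rw [← σ.2, ← τ.2]; exact Quotient.sound hs)
    have h1 := congrArg (fun B => opCLM B v) h0
    simp only [opCLM_mul_apply, opCLM_projMat, map_zero] at h1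
    rwa [Submodule.starProjection_eq_self_iff.mpr hv] at h1
  refine opCLM_ext fun v => ?_
  rw [opCLM_mul_apply, opCLM_mul_apply, isotypicMat, isotypicMat, opCLM_projMat, opCLM_projMat,
    map_zero]
  exact (Submodule.starProjection_apply_eq_zero_iff _).mpr
    (hle (Submodule.starProjection_apply_mem _ v))

/-- `Π_μ` is central in the algebra of invariant operators. -/
lemma isotypicMat_comm (hA : IsInvariant u A) (μ : Irreps u n) :
    A * isotypicMat u n μ = isotypicMat u n μ * A := by
  have h1 : A * isotypicMat u n μ = isotypicMat u n μ * A * isotypicMat u n μ := by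
    calc A * isotypicMat u n μ = (∑ ν, isotypicMat u n ν) * A * isotypicMat u n μ := by
          rw [sum_isotypicMat, one_mul]
      _ = _ := by
          rw [Finset.sum_mul, Finset.sum_mul, Finset.sum_eq_single μ
            (fun ν _ h => isotypicMat_mul_mul_of_ne hA h.symm) (by simp)]
  have h2 : isotypicMat u n μ * A = isotypicMat u n μ * A * isotypicMat u n μ := by
    calc isotypicMat u n μ * A = isotypicMat u n μ * A * (∑ ν, isotypicMat u n ν) := by
          rw [sum_isotypicMat, mul_one]
      _ = _ := by
          rw [Finset.mul_sum, Finset.sum_eq_single μ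
            (fun ν _ h => isotypicMat_mul_mul_of_ne hA h) (by simp)]
  rw [h1, ← h2]

lemma isotypicMat_mul_projMat (σ : IrreducibleSub u n) :
    isotypicMat u n ⟦σ⟧ * projMat σ.1.toSubmodule = projMat σ.1.toSubmodule :=
  projMat_mul_projMat_of_le (le_isotypic σ)

lemma isotypicMat_mul_projMat_of_ne {σ : IrreducibleSub u n} {μ : Irreps u n} (h : μ ≠ ⟦σ⟧) :
    isotypicMat u n μ * projMat σ.1.toSubmodule = 0 :=
  projMat_mul_projMat_of_isOrtho ((isotypic_isOrtho_of_ne h).mono_right (le_isotypic σ))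

lemma trace_projMat_ne_zero (σ : IrreducibleSub u n) : (projMat σ.1.toSubmodule).trace ≠ 0 := by
  rw [trace_projMat, Nat.cast_ne_zero]
  exact Nat.one_le_iff_ne_zero.mp (Submodule.one_le_finrank_iff.mpr (irreducibleSub_ne_bot σ))

lemma trace_isotypicMat_ne_zero (μ : Irreps u n) : (isotypicMat u n μ).trace ≠ 0 := by
  rw [isotypicMat, trace_projMat, Nat.cast_ne_zero]
  exact Nat.one_le_iff_ne_zero.mp (Submodule.one_le_finrank_iff.mpr (isotypic_ne_bot μ))

lemma chargeVector_apply (A : Op d n) (μ : Irreps u n) :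
    chargeVector u n A μ = (isotypicMat u n μ * A).trace := by
  rw [trace_eq_trace_opCLM, map_mul, isotypicMat, opCLM_projMat]
  rfl

end Isotypic

/-! ### Tracial functionals on the algebra of invariant operators -/

section Tracial
variable {n : ℕ}

variable (u) in
/-- A linear functional which is a trace on the algebra of invariant operators. -/
def IsTracial (φ : Op d n →ₗ[ℂ] ℂ) : Prop :=
  ∀ A B : Op d n, IsInvariant u A → IsInvariant u B → φ (A * B) = φ (B * A)

/-- A tracial functional that vanishes on the projectors to irreducible subrepresentations vanishes
on all invariant operators: by Schur's lemma, an invariant operator compressed to an irreducible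
subrepresentation is a multiple of the projector. -/
lemma IsTracial.eq_zero {φ : Op d n →ₗ[ℂ] ℂ} (hφ : IsTracial u φ)
    (h0 : ∀ σ : IrreducibleSub u n, φ (projMat σ.1.toSubmodule) = 0) {A : Op d n}
    (hA : IsInvariant u A) : φ A = 0 := by
  have key : ∀ m : ℕ, ∀ τ : Subrepresentation (siteRep u n),
      Module.finrank ℂ τ.toSubmodule = m →
      φ (projMat τ.toSubmodule * A * projMat τ.toSubmodule) = 0 := by
    intro m
    induction m using Nat.strong_induction_on with
    | _ m ih =>
    intro τ hm
    by_cases hτ : τ = ⊥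
    · have : τ.toSubmodule = ⊥ := congrArg Subrepresentation.toSubmodule hτ
      rw [this, projMat_bot]; simp
    obtain ⟨σ, hσ⟩ := exists_irreducibleSub_le hτ
    set υ : Subrepresentation (siteRep u n) := τ ⊓ orthogonalSub σ.1 with hυ
    have hυle : υ.toSubmodule ≤ τ.toSubmodule := inf_le_left
    have hυσ : σ.1.toSubmodule ⟂ υ.toSubmodule :=
      (Submodule.isOrtho_orthogonal_right _).mono_right inf_le_right
    have hσυ : σ.1.toSubmodule ⊓ υ.toSubmodule = ⊥ := hυσ.disjoint.eq_bot
    have hlt : Module.finrank ℂ υ.toSubmodule < m := by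
      rw [← hm]
      refine Submodule.finrank_lt_finrank_of_lt (lt_of_le_of_ne hυle fun h => ?_)
      apply irreducibleSub_ne_bot σ
      rw [← hσυ, h]
      exact (inf_eq_left.mpr (show σ.1.toSubmodule ≤ τ.toSubmodule from hσ)).symm
    -- the projector onto `τ` is the sum of the projectors onto `σ` and its complement in `τ`
    have hsum : projMat τ.toSubmodule =
        projMat σ.1.toSubmodule + projMat υ.toSubmodule := by
      refine opCLM_ext fun v => ?_
      rw [map_add, opCLM_projMat, opCLM_projMat, opCLM_projMat, add_apply]
      symm
      have hστ : σ.1.toSubmodule.starProjection (τ.toSubmodule.starProjection v) =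
          σ.1.toSubmodule.starProjection v := by
        have := congrArg (fun B => opCLM B v) (projMat_mul_projMat_of_le' (W := σ.1.toSubmodule) hσ)
        simpa only [opCLM_mul_apply, opCLM_projMat] using this
      have hυτ : υ.toSubmodule.starProjection (τ.toSubmodule.starProjection v) =
          υ.toSubmodule.starProjection v := by
        have := congrArg (fun B => opCLM B v) (projMat_mul_projMat_of_le' hυle)
        simpa only [opCLM_mul_apply, opCLM_projMat] using this
      set w := τ.toSubmodule.starProjection v
      have hw : w ∈ τ.toSubmodule := Submodule.starProjection_apply_mem _ _
      rw [← hστ, ← hυτ]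
      have h1 : w - σ.1.toSubmodule.starProjection w ∈ υ.toSubmodule :=
        ⟨sub_mem hw (hσ (Submodule.starProjection_apply_mem _ _)),
          Submodule.sub_starProjection_mem_orthogonal _⟩
      have h2 : υ.toSubmodule.starProjection (σ.1.toSubmodule.starProjection w) = 0 :=
        (Submodule.starProjection_apply_eq_zero_iff _).mpr
          (hυσ (Submodule.starProjection_apply_mem _ _))
      have h3 := Submodule.starProjection_eq_self_iff.mpr h1
      rw [map_sub, h2, sub_zero] at h3
      rw [h3]; abel
    have hPσ := isInvariant_projMat σ.1
    have hPυ := isInvariant_projMat υ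
    have hz : projMat σ.1.toSubmodule * projMat υ.toSubmodule = 0 :=
      projMat_mul_projMat_of_isOrtho hυσ
    have hz' : projMat υ.toSubmodule * projMat σ.1.toSubmodule = 0 :=
      projMat_mul_projMat_of_isOrtho hυσ.symm
    obtain ⟨c, hc⟩ := exists_projMat_mul_mul_projMat_eq_smul σ hA
    rw [hsum, add_mul, add_mul, mul_add, mul_add, map_add, map_add, map_add, hc, map_smul, h0,
      ih _ hlt υ rfl, hφ _ _ (hPσ.mul hA) hPυ, hφ _ _ (hPυ.mul hA) hPσ, ← mul_assoc, ← mul_assoc,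
      hz, hz']
    simp
  have := key _ ⊤ rfl
  rwa [show (⊤ : Subrepresentation (siteRep u n)).toSubmodule = ⊤ from rfl, projMat_top, one_mul,
    mul_one] at this

lemma IsTracial.projMat_eq {φ : Op d n →ₗ[ℂ] ℂ} (hφ : IsTracial u φ) {σ τ : IrreducibleSub u n}
    (h : σ ≈ τ) : φ (projMat σ.1.toSubmodule) = φ (projMat τ.1.toSubmodule) := by
  obtain ⟨e⟩ := h
  have key : ∀ {σ τ : IrreducibleSub u n} (e : σ.1.toRepresentation.Equiv τ.1.toRepresentation),
      extendIntertwining e.symm.toIntertwiningMap * extendIntertwining e.toIntertwiningMap =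
        projMat σ.1.toSubmodule := by
    intro σ τ e
    refine opCLM_ext fun v => ?_
    rw [opCLM_mul_apply, opCLM_extendIntertwining, opCLM_extendIntertwining, opCLM_projMat,
      Submodule.orthogonalProjectionOnto_mem_subspace_eq_self]
    simp
  rw [← key e, hφ _ _ (isInvariant_extendIntertwining _) (isInvariant_extendIntertwining _),
    ← key e.symm]
  rfl

/-- Charge vectors are tracial: they vanish on commutators of invariant operators. -/
lemma chargeVector_mul_comm {A B : Op d n} (hA : IsInvariant u A) :
    chargeVector u n (A * B) = chargeVector u n (B * A) := by
  ext μ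
  rw [chargeVector_apply, chargeVector_apply, ← mul_assoc, ← isotypicMat_comm hA, mul_assoc,
    Matrix.trace_mul_comm, mul_assoc]

/-- Every tracial functional on the algebra of invariant operators is a linear combination of the
charges `A ↦ Tr (Π_μ A)`. -/
lemma IsTracial.exists_weights {φ : Op d n →ₗ[ℂ] ℂ} (hφ : IsTracial u φ) :
    ∃ w : Irreps u n → ℂ, ∀ A, IsInvariant u A → φ A = ∑ μ, w μ * chargeVector u n A μ := by
  refine ⟨fun μ => φ (projMat μ.out.1.toSubmodule) / (projMat μ.out.1.toSubmodule).trace, ?_⟩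
  set w : Irreps u n → ℂ :=
    fun μ => φ (projMat μ.out.1.toSubmodule) / (projMat μ.out.1.toSubmodule).trace with hw
  intro A hA
  let ψ : Op d n →ₗ[ℂ] ℂ := φ - ∑ μ, w μ • (LinearMap.proj μ ∘ₗ chargeVector u n)
  have hψ : ∀ B, ψ B = φ B - ∑ μ, w μ * chargeVector u n B μ := fun B => by
    simp [ψ, LinearMap.sum_apply]
  have htr : IsTracial u ψ := by
    intro B C hB hC
    rw [hψ, hψ, hφ B C hB hC, chargeVector_mul_comm hB]
  refine sub_eq_zero.mp ((hψ A).symm.trans (htr.eq_zero (fun σ => ?_) hA))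
  have hσ : (⟦σ⟧ : Irreps u n).out ≈ σ := Quotient.mk_out σ
  have ht : IsTracial u (Matrix.traceLinearMap (Conf d n) ℂ ℂ) :=
    fun B C _ _ => Matrix.trace_mul_comm B C
  have htr' : (projMat (⟦σ⟧ : Irreps u n).out.1.toSubmodule).trace =
      (projMat σ.1.toSubmodule).trace := ht.projMat_eq hσ
  rw [hψ, Finset.sum_eq_single ⟦σ⟧, chargeVector_apply, isotypicMat_mul_projMat, hw]
  · dsimp only
    rw [htr', hφ.projMat_eq hσ, div_mul_cancel₀ _ (trace_projMat_ne_zero σ), sub_self]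
  · intro μ _ h
    rw [chargeVector_apply, isotypicMat_mul_projMat_of_ne h, Matrix.trace_zero, mul_zero]
  · simp

end Tracial

/-! ### The isotypic projectors lie in the span of the group -/

section Density
variable {n : ℕ}

open Representation in
/-- A linear functional `Tr (M ·)` that vanishes on the group vanishes on the isotypic projectors:
by the Jacobson density theorem, these are linear combinations of the operators `U(g)`. -/
lemma trace_mul_isotypicMat_eq_zero {M : Op d n}
    (h : ∀ g : G, (M * (tensorRep u n g : Op d n)).trace = 0) (μ : Irreps u n) :
    (M * isotypicMat u n μ).trace = 0 := by
  let ρ := siteRep u n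
  have hss : IsSemisimpleRepresentation ρ := ⟨fun σ => ⟨orthogonalSub σ, by
    constructor
    · rw [disjoint_iff]
      exact Subrepresentation.toSubmodule_injective
        (Submodule.inf_orthogonal_eq_bot σ.toSubmodule)
    · rw [codisjoint_iff]
      exact Subrepresentation.toSubmodule_injective
        (Submodule.sup_orthogonal_of_hasOrthogonalProjection)⟩⟩
  have hsm := (isSemisimpleRepresentation_iff_isSemisimpleModule_asModule ρ).mp hss
  -- every module endomorphism commutes with the isotypic projector
  have hcomm : ∀ (e : Module.End (MonoidAlgebra ℂ G) ρ.asModule) (v : EuclideanSpace ℂ (Conf d n)),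
      ρ.asModuleEquiv (e (ρ.asModuleEquiv.symm (opCLM (isotypicMat u n μ) v))) =
        opCLM (isotypicMat u n μ) (ρ.asModuleEquiv (e (ρ.asModuleEquiv.symm v))) := by
    intro e
    let L : EuclideanSpace ℂ (Conf d n) →ₗ[ℂ] EuclideanSpace ℂ (Conf d n) :=
      ((IntertwiningMap.equivAlgEnd (ρ := ρ)).symm e).toLinearMap
    have hL : ∀ v, ρ.asModuleEquiv (e (ρ.asModuleEquiv.symm v)) = L v := by
      intro v
      conv_lhs => rw [← (IntertwiningMap.equivAlgEnd (ρ := ρ)).apply_symm_apply e]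
      rfl
    let B : Op d n := opCLM.symm (LinearMap.toContinuousLinearMap L)
    have hB : ∀ v, opCLM B v = L v := fun v => by simp [B]
    have hinv : IsInvariant u B := fun g => opCLM_ext fun v => by
      rw [opCLM_mul_apply, opCLM_mul_apply, hB, hB]
      exact IntertwiningMap.isIntertwining _ _ ((IntertwiningMap.equivAlgEnd (ρ := ρ)).symm e) g v
    intro v
    rw [hL, hL, ← hB, ← hB, ← opCLM_mul_apply, ← opCLM_mul_apply, isotypicMat_comm hinv]
  let f : Module.End (Module.End (MonoidAlgebra ℂ G) ρ.asModule) ρ.asModule :=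
    { toFun := fun v => ρ.asModuleEquiv.symm (opCLM (isotypicMat u n μ) (ρ.asModuleEquiv v))
      map_add' := fun v w => by simp only [map_add]
      map_smul' := fun e v => ρ.asModuleEquiv.injective (by
        have := hcomm e (ρ.asModuleEquiv v)
        simp only [LinearEquiv.symm_apply_apply] at this
        simp only [Module.End.smul_def, LinearEquiv.apply_symm_apply, RingHom.id_apply]
        exact this.symm) }
  classical
  let b := Module.finBasis ℂ (EuclideanSpace ℂ (Conf d n))
  obtain ⟨r, hr⟩ := jacobson_density f (Finset.univ.image fun i => ρ.asModuleEquiv.symm (b i))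
  have hr' : (opCLM (isotypicMat u n μ)).toLinearMap = ρ.asAlgebraHom r := by
    refine b.ext fun i => ?_
    have h1 := hr _ (Finset.mem_image_of_mem _ (Finset.mem_univ i))
    have h2 := congrArg ρ.asModuleEquiv h1
    rw [asModuleEquiv_map_smul, LinearEquiv.apply_symm_apply] at h2
    rw [← h2]
    simp [f]
  let T : Module.End ℂ (EuclideanSpace ℂ (Conf d n)) →ₗ[ℂ] ℂ :=
    LinearMap.trace ℂ _ ∘ₗ LinearMap.mulLeft ℂ (opCLM M).toLinearMap
  have hT : ∀ A : Op d n, T (opCLM A).toLinearMap = (M * A).trace := fun A => by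
    rw [trace_eq_trace_opCLM, map_mul]; rfl
  have h0 : ∀ r, T (ρ.asAlgebraHom r) = 0 := by
    intro r
    induction r using MonoidAlgebra.induction_linear with
    | zero => simp
    | add x y hx hy => rw [map_add, map_add, hx, hy, add_zero]
    | single g a =>
      rw [asAlgebraHom_single, map_smul, show ρ g = (opCLM (tensorRep u n g : Op d n)).toLinearMap
        from rfl, hT, h, smul_zero]
  rw [← hT, hr', h0]

end Density

/-! ### Tensor products and permutations of sites -/

section Tensor
variable {k m n : ℕ}

/-- The operator `A ⊗ B` on `k + m` sites. -/
def tens (A : Op d k) (B : Op d m) : Op d (k + m) :=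
  (Matrix.kronecker A B).submatrix (Fin.appendEquiv k m).symm (Fin.appendEquiv k m).symm

lemma tens_apply (A : Op d k) (B : Op d m) (x y : Conf d (k + m)) :
    tens A B x y = A (fun i => x (Fin.castAdd m i)) (fun i => y (Fin.castAdd m i)) *
      B (fun i => x (Fin.natAdd k i)) (fun i => y (Fin.natAdd k i)) := rfl

lemma tens_append (A : Op d k) (B : Op d m) (x y : Conf d k) (x' y' : Conf d m) :
    tens A B (Fin.append x x') (Fin.append y y') = A x y * B x' y' := by
  simp [tens_apply]

lemma tens_mul (A A' : Op d k) (B B' : Op d m) :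
    tens A B * tens A' B' = tens (A * A') (B * B') := by
  rw [tens, tens, Matrix.submatrix_mul_equiv, tens]
  exact congrArg (fun M => Matrix.submatrix M _ _) (Matrix.mul_kronecker_mul A A' B B').symm

lemma tens_one_one : tens (1 : Op d k) (1 : Op d m) = 1 := by
  rw [tens]
  exact (congrArg (fun M => Matrix.submatrix M _ _) Matrix.one_kronecker_one).trans
    (Matrix.submatrix_one_equiv _)

lemma trace_tens (A : Op d k) (B : Op d m) : (tens A B).trace = A.trace * B.trace := by
  rw [← Matrix.trace_kronecker]
  exact (Fin.appendEquiv k m).symm.sum_comp fun x => (Matrix.kronecker A B) x x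

lemma conjTranspose_tens (A : Op d k) (B : Op d m) : (tens A B)ᴴ = tens Aᴴ Bᴴ := by
  ext x y; simp [tens_apply]

lemma tensorRep_add (g : G) :
    (tensorRep u (k + m) g : Op d (k + m)) =
      tens (tensorRep u k g : Op d k) (tensorRep u m g : Op d m) := by
  ext x y
  exact Fin.prod_univ_add _

variable (d k m) in
/-- The inclusion `A ↦ A ⊗ 1` of the operators on the first `k` sites. -/
def tensOne : Op d k →ₐ[ℂ] Op d (k + m) where
  toFun A := tens A 1
  map_one' := tens_one_one
  map_mul' A B := by rw [tens_mul, one_mul]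
  map_zero' := by ext; simp [tens_apply]
  map_add' A B := by ext; simp [tens_apply, add_mul]
  commutes' c := by
    rw [Algebra.algebraMap_eq_smul_one, Algebra.algebraMap_eq_smul_one, ← tens_one_one]
    ext; simp [tens_apply, mul_assoc]

lemma tensOne_apply (A : Op d k) : tensOne d k m A = tens A 1 := rfl

lemma conjTranspose_tensOne (A : Op d k) : (tensOne d k m A)ᴴ = tensOne d k m Aᴴ := by
  rw [tensOne_apply, conjTranspose_tens, Matrix.conjTranspose_one, tensOne_apply]

lemma IsInvariant.tens {A : Op d k} {B : Op d m} (hA : IsInvariant u A) (hB : IsInvariant u B) :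
    IsInvariant u (tens A B) := fun g => by
  rw [tensorRep_add, tens_mul, tens_mul, hA g, hB g]

lemma IsInvariant.tensOne {A : Op d k} (hA : IsInvariant u A) :
    IsInvariant u (tensOne d k m A) := hA.tens isInvariant_one

lemma tens_left_injective {B : Op d m} (hB : B ≠ 0) {A A' : Op d k}
    (h : LSQC.tens A B = LSQC.tens A' B) : A = A' := by
  obtain ⟨x', y', h'⟩ : ∃ x y, B x y ≠ 0 := by
    by_contra! h0
    exact hB (by ext x y; exact h0 x y)
  ext x y
  have := congrFun (congrFun h (Fin.append x x')) (Fin.append y y')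
  rw [tens_append, tens_append] at this
  exact mul_right_cancel₀ h' this

lemma tensOne_injective [Nonempty (Conf d m)] : Function.Injective (LSQC.tensOne d k m) :=
  fun _ _ h => tens_left_injective one_ne_zero h

lemma isInvariant_of_tensOne [Nonempty (Conf d m)] {A : Op d k}
    (h : IsInvariant u (LSQC.tensOne d k m A)) : IsInvariant u A := fun g => by
  have hU : (tensorRep u m g : Op d m) ≠ 0 := fun h0 => by
    have := Matrix.mem_unitaryGroup_iff.mp (tensorRep u m g).2
    rw [h0, zero_mul] at this
    exact zero_ne_one this
  have := h g
  rw [tensorRep_add, tensOne_apply, tens_mul, tens_mul, one_mul, mul_one] at this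
  exact tens_left_injective hU this

lemma isLocal_tensOne (A : Op d k) : IsLocal k (LSQC.tensOne d k m A) := by
  let e : Fin k → (Finset.univ.map (Fin.castAddEmb m) : Finset (Fin (k + m))) :=
    fun i => ⟨Fin.castAdd m i, by simp⟩
  refine ⟨Finset.univ.map (Fin.castAddEmb m), by simp,
    fun x y => A (fun i => x (e i)) (fun i => y (e i)), fun x y h => ?_, ?_⟩
  · have : (fun i => x (Fin.natAdd k i)) = fun i => y (Fin.natAdd k i) :=
      funext fun i => h _ (by simp [Fin.ext_iff]; omega)
    rw [tensOne_apply, tens_apply, this, Matrix.one_apply_eq, mul_one]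
  · rintro x y ⟨i, hi, hne⟩
    rw [tensOne_apply, tens_apply, Matrix.one_apply_ne, mul_zero]
    intro h
    induction i using Fin.addCases with
    | left i => exact hi (by simp)
    | right i => exact hne (congrFun h i)

/-- Relabelling the sites by a permutation. -/
def permuteSites (π : Equiv.Perm (Fin n)) : Op d n ≃ₐ[ℂ] Op d n :=
  Matrix.reindexAlgEquiv ℂ ℂ (π.arrowCongr (Equiv.refl (Fin d)))

lemma permuteSites_apply (π : Equiv.Perm (Fin n)) (A : Op d n) (x y : Conf d n) :
    permuteSites π A x y = A (x ∘ π) (y ∘ π) := rfl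

/-- The unitary operator that permutes the sites. -/
def permMat (π : Equiv.Perm (Fin n)) : Op d n := (1 : Op d n).submatrix (fun x => x ∘ π) id

lemma permMat_mul (π : Equiv.Perm (Fin n)) (A : Op d n) :
    permMat π * A = A.submatrix (fun x => x ∘ π) id := by
  ext x y
  simp [permMat, Matrix.mul_apply, Matrix.one_apply]

lemma permuteSites_mul_permMat (π : Equiv.Perm (Fin n)) (A : Op d n) :
    permuteSites π A * permMat π = permMat π * A := by
  rw [permMat_mul]
  ext x y
  rw [Matrix.mul_apply]
  refine ((π.arrowCongr (Equiv.refl (Fin d))).symm.sum_comp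
    (fun w => A (x ∘ π) w * (1 : Op d n) w y)).trans ?_
  simp [Matrix.one_apply]

lemma permMat_mul_conjTranspose (π : Equiv.Perm (Fin n)) :
    (permMat π : Op d n) * (permMat π)ᴴ = 1 := by
  rw [permMat_mul]
  ext x y
  simp only [permMat, Matrix.submatrix_apply, Matrix.conjTranspose_apply, id, Matrix.one_apply,
    (Function.Surjective.right_cancellable π.surjective)]
  split_ifs <;> simp_all

lemma permuteSites_eq (π : Equiv.Perm (Fin n)) (A : Op d n) :
    permuteSites π A = permMat π * A * (permMat π)ᴴ := by
  rw [← permuteSites_mul_permMat, mul_assoc, permMat_mul_conjTranspose, mul_one]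

lemma trace_permuteSites (π : Equiv.Perm (Fin n)) (A : Op d n) :
    (permuteSites π A).trace = A.trace :=
  (π.arrowCongr (Equiv.refl (Fin d))).symm.sum_comp fun x => A x x

lemma permuteSites_conjTranspose (π : Equiv.Perm (Fin n)) (A : Op d n) :
    (permuteSites π A)ᴴ = permuteSites π Aᴴ := rfl

lemma permuteSites_tensorRep (π : Equiv.Perm (Fin n)) (g : G) :
    permuteSites π (tensorRep u n g : Op d n) = tensorRep u n g := by
  ext x y
  exact Equiv.prod_comp π fun i => (u g : Matrix (Fin d) (Fin d) ℂ) (x i) (y i)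

lemma isInvariant_permMat (π : Equiv.Perm (Fin n)) : IsInvariant u (permMat π : Op d n) :=
  fun g => by rw [← permuteSites_mul_permMat, permuteSites_tensorRep]

lemma IsInvariant.permuteSites (π : Equiv.Perm (Fin n)) {A : Op d n} (hA : IsInvariant u A) :
    IsInvariant u (permuteSites π A) := fun g => by
  rw [← permuteSites_tensorRep π g, ← map_mul, hA g, map_mul]

lemma permuteSites_isotypicMat (π : Equiv.Perm (Fin n)) (μ : Irreps u n) :
    LSQC.permuteSites π (isotypicMat u n μ) = isotypicMat u n μ := by
  rw [permuteSites_eq, isotypicMat_comm (isInvariant_permMat π), mul_assoc,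
    permMat_mul_conjTranspose, mul_one]

lemma chargeVector_permuteSites (π : Equiv.Perm (Fin n)) (A : Op d n) :
    chargeVector u n (LSQC.permuteSites π A) = chargeVector u n A := by
  ext μ
  rw [chargeVector_apply, chargeVector_apply, ← permuteSites_isotypicMat π μ, ← map_mul,
    trace_permuteSites, permuteSites_isotypicMat]

/-- Up to a permutation of the sites, a `k`-local operator acts on the first `k` sites only. -/
lemma IsLocal.exists_permuteSites_eq [Nonempty (Conf d m)] {A : Op d (k + m)} (hA : IsLocal k A) :
    ∃ (π : Equiv.Perm (Fin (k + m))) (A' : Op d k), LSQC.permuteSites π A = tensOne d k m A' := by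
  obtain ⟨S, hS, B, hB, hB0⟩ := hA
  obtain ⟨T, hT, hTc⟩ := Finset.exists_subset_card_eq
    (s := (Finset.univ.map (Fin.castAddEmb m) : Finset (Fin (k + m)))) (n := S.card) (by simpa)
  let π : Equiv.Perm (Fin (k + m)) := (Finset.equivOfCardEq hTc.symm).extendSubtype
  have hπ : ∀ i ∈ S, ∃ j : Fin k, Fin.castAdd m j = π i := fun i hi => by
    have := hT ((Finset.equivOfCardEq hTc.symm).extendSubtype_mem i hi)
    simpa using this
  -- the entries of the permuted operator do not depend on the configuration `y₀` of the last sites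
  obtain ⟨y₀⟩ := ‹Nonempty (Conf d m)›
  refine ⟨π, Matrix.of fun x x' =>
    LSQC.permuteSites π A (Fin.append x y₀) (Fin.append x' y₀), ?_⟩
  ext X X'
  obtain ⟨x, y, rfl⟩ : ∃ x y, Fin.append x y = X := ⟨_, _, Fin.append_castAdd_natAdd⟩
  obtain ⟨x', y', rfl⟩ : ∃ x y, Fin.append x y = X' := ⟨_, _, Fin.append_castAdd_natAdd⟩
  rw [tensOne_apply, tens_append, permuteSites_apply, Matrix.of_apply]
  by_cases hy : y = y'
  · subst hy
    have hindep : ∀ i, Fin.append x y (π i) = Fin.append x' y (π i) ↔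
        Fin.append x y₀ (π i) = Fin.append x' y₀ (π i) := fun i => by
      induction π i using Fin.addCases with
      | left j => simp
      | right j => simp
    rw [Matrix.one_apply_eq, mul_one, permuteSites_apply]
    by_cases h : ∀ i ∉ S, Fin.append x y (π i) = Fin.append x' y (π i)
    · rw [hB (Fin.append x y ∘ π) (Fin.append x' y ∘ π) h,
        hB (Fin.append x y₀ ∘ π) (Fin.append x' y₀ ∘ π) fun i hi => (hindep i).mp (h i hi)]
      congr 1 <;>
      · ext i
        obtain ⟨j, hj⟩ := hπ i i.2
        simp [← hj]
    · push Not at h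
      obtain ⟨i, hi, hne⟩ := h
      rw [hB0 (Fin.append x y ∘ π) (Fin.append x' y ∘ π) ⟨i, hi, hne⟩,
        hB0 (Fin.append x y₀ ∘ π) (Fin.append x' y₀ ∘ π)
          ⟨i, hi, fun h => hne ((hindep i).mpr h)⟩]
  · rw [Matrix.one_apply_ne hy, mul_zero]
    obtain ⟨j, hj⟩ := Function.ne_iff.mp hy
    refine hB0 _ _ ⟨π.symm (Fin.natAdd k j), fun h => ?_, by simpa using hj⟩
    obtain ⟨l, hl⟩ := hπ _ h
    simp [Fin.ext_iff] at hl
    omega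

end Tensor

/-! ### Charge spaces -/

section Charges
variable {k m n : ℕ}

variable (u n) in
/-- The real vector space of invariant Hermitian operators. -/
def invariantHermitian : Submodule ℝ (Op d n) where
  carrier := {A | A.IsHermitian ∧ IsInvariant u A}
  zero_mem' := ⟨Matrix.isHermitian_zero, isInvariant_zero⟩
  add_mem' hA hB := ⟨hA.1.add hB.1, hA.2.add hB.2⟩
  smul_mem' c A hA := ⟨by
    simp only [Matrix.IsHermitian, Matrix.conjTranspose_smul, star_trivial, hA.1.eq], by
    rw [← Complex.coe_smul]; exact hA.2.smul _⟩

variable (u k m) in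
/-- The charge vectors, on `k + m` sites, of the invariant Hermitian operators on the first `k`
sites. -/
def localCharges : Submodule ℝ (Irreps u (k + m) → ℂ) :=
  (invariantHermitian u k).map
    ((chargeVector u (k + m) ∘ₗ (tensOne d k m).toLinearMap).restrictScalars ℝ)

variable (u n) in
/-- The map `X ↦ |χ_{-iX}⟩`, which takes `𝔥_k` onto `𝒮_k`. -/
def chargeMap : Op d n →ₗ[ℝ] (Irreps u n → ℂ) :=
  ((-Complex.I) • chargeVector u n).restrictScalars ℝ

lemma chargeMap_apply (X : Op d n) : chargeMap u n X = chargeVector u n (-Complex.I • X) := by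
  rw [map_smul]; rfl

lemma chargeSpace_eq_map : chargeSpace u n k =
    (localLieAlgebra u n k).toSubmodule.map (chargeMap u n) := by
  ext χ
  constructor
  · rintro ⟨A, hA, rfl⟩
    refine ⟨Complex.I • A, hA, ?_⟩
    rw [chargeMap_apply, smul_smul]
    simp
  · rintro ⟨X, hX, rfl⟩
    refine ⟨-Complex.I • X, ?_, (chargeMap_apply X).symm⟩
    have : Complex.I • (-Complex.I • X) = X := by rw [smul_smul]; simp
    change Complex.I • (-Complex.I • X) ∈ localLieAlgebra u n k
    rwa [this]

lemma isSkew_I_smul {A : Op d n} (hA : A.IsHermitian) :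
    Complex.I • A + (Complex.I • A)ᴴ = 0 := by
  rw [Matrix.conjTranspose_smul, hA.eq]; simp

lemma isHermitian_neg_I_smul {X : Op d n} (hX : X + Xᴴ = 0) : (-Complex.I • X).IsHermitian := by
  rw [Matrix.IsHermitian, Matrix.conjTranspose_smul, eq_neg_of_add_eq_zero_right hX]
  simp

/-- `𝒮_k` consists of the charge vectors of the invariant Hermitian operators on the first `k`
sites: commutators have no charges, and permuting the sites does not change the charges. -/
theorem chargeSpace_eq_localCharges : chargeSpace u (k + m) k = localCharges u k m := by
  apply le_antisymm
  · -- if `d = 0` and `m > 0`, the Hilbert space is zero and there are no charges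
    rcases isEmpty_or_nonempty (Conf d m) with hm | hm
    · have : IsEmpty (Conf d (k + m)) := ⟨fun x => hm.elim fun i => x (Fin.natAdd k i)⟩
      have : IsEmpty (Irreps u (k + m)) := ⟨fun μ => trace_isotypicMat_ne_zero μ (by
        simp [Matrix.trace])⟩
      exact fun χ _ => by rw [Subsingleton.elim χ 0]; exact Submodule.zero_mem _
    let L : LieSubalgebra ℝ (Op d (k + m)) :=
      { carrier := {X | IsInvariant u X ∧ chargeMap u (k + m) X ∈ localCharges u k m}
        zero_mem' := ⟨isInvariant_zero, by rw [map_zero]; exact Submodule.zero_mem _⟩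
        add_mem' := fun hX hY => ⟨hX.1.add hY.1, by
          rw [map_add]; exact Submodule.add_mem _ hX.2 hY.2⟩
        smul_mem' := fun c X hX => ⟨by rw [← Complex.coe_smul]; exact hX.1.smul _, by
          rw [map_smul]; exact Submodule.smul_mem _ _ hX.2⟩
        lie_mem' := fun {X Y} hX hY => by
          refine ⟨?_, ?_⟩
          · rw [Ring.lie_def]
            exact (hX.1.mul hY.1).sub (hY.1.mul hX.1)
          · rw [Ring.lie_def, chargeMap_apply, map_smul, map_sub, chargeVector_mul_comm hX.1,
              sub_self, smul_zero]
            exact Submodule.zero_mem _ }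
    have hL : localLieAlgebra u (k + m) k ≤ L := by
      rw [localLieAlgebra, LieSubalgebra.lieSpan_le]
      rintro X ⟨hloc, hskew, hinv⟩
      refine ⟨hinv, ?_⟩
      obtain ⟨π, A, hA⟩ := hloc.exists_permuteSites_eq
      have hAinv : IsInvariant u A := isInvariant_of_tensOne (hA ▸ hinv.permuteSites π)
      have hAskew : A + Aᴴ = 0 := tensOne_injective (m := m) (by
        rw [map_add, ← conjTranspose_tensOne, ← hA, permuteSites_conjTranspose, ← map_add, hskew,
          map_zero, map_zero])
      refine ⟨-Complex.I • A, ⟨isHermitian_neg_I_smul hAskew, hAinv.smul _⟩, ?_⟩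
      change chargeVector u (k + m) (tensOne d k m (-Complex.I • A)) = _
      rw [chargeMap_apply, map_smul, ← hA, ← map_smul, chargeVector_permuteSites]
    rw [chargeSpace_eq_map, Submodule.map_le_iff_le_comap]
    exact fun X hX => (hL hX).2
  · rintro _ ⟨A, ⟨hA, hAinv⟩, rfl⟩
    refine ⟨tensOne d k m A, ?_, rfl⟩
    have hherm : (tensOne d k m A).IsHermitian := by
      rw [Matrix.IsHermitian, conjTranspose_tensOne, hA.eq]
    refine LieSubalgebra.subset_lieSpan ⟨?_, isSkew_I_smul hherm, hAinv.tensOne.smul _⟩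
    change IsLocal k (Complex.I • tensOne d k m A)
    rw [← map_smul]
    exact isLocal_tensOne _

lemma star_chargeVector {A : Op d n} (hA : A.IsHermitian) (μ : Irreps u n) :
    star (chargeVector u n A μ) = chargeVector u n A μ := by
  rw [chargeVector_apply, ← Matrix.trace_conjTranspose, Matrix.conjTranspose_mul, hA.eq,
    isotypicMat, projMat_isHermitian.eq, Matrix.trace_mul_comm]

/-- The charges of `A ⊗ 1` are determined by those of `A`, so `𝒮_k` has dimension at most the number
of charges on `k` sites. -/
theorem finrank_localCharges_le : Module.finrank ℝ (localCharges u k m) ≤ numIrreps u k := by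
  have htr : ∀ μ : Irreps u (k + m), IsTracial u
      (LinearMap.proj μ ∘ₗ chargeVector u (k + m) ∘ₗ (tensOne d k m).toLinearMap) := by
    intro μ A B hA hB
    simp only [LinearMap.comp_apply, AlgHom.toLinearMap_apply, map_mul]
    rw [chargeVector_mul_comm hA.tensOne]
  choose w hw using fun μ => (htr μ).exists_weights
  let F : (Irreps u k → ℝ) →ₗ[ℝ] (Irreps u (k + m) → ℂ) :=
    (Matrix.mulVecLin (Matrix.of w)).restrictScalars ℝ ∘ₗ
      Complex.ofRealCLM.toLinearMap.compLeft (Irreps u k)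
  have hle : localCharges u k m ≤ LinearMap.range F := by
    rintro _ ⟨A, ⟨hA, hAinv⟩, rfl⟩
    refine ⟨fun ν => (chargeVector u k A ν).re, ?_⟩
    ext μ
    refine Eq.trans ?_ (hw μ A hAinv).symm
    refine Finset.sum_congr rfl fun ν _ => ?_
    change w μ ν * (((chargeVector u k A ν).re : ℝ) : ℂ) = _
    rw [Complex.conj_eq_iff_re.mp (star_chargeVector hA ν)]
  calc Module.finrank ℝ (localCharges u k m) ≤ Module.finrank ℝ (LinearMap.range F) :=
        Submodule.finrank_mono hle
    _ ≤ Module.finrank ℝ (Irreps u k → ℝ) := LinearMap.finrank_range_le F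
    _ = numIrreps u k := by rw [Module.finrank_fintype_fun_eq_card, numIrreps_eq_card]

/-- If `A ↦ |χ_{A ⊗ 1}⟩` is injective on the span of the isotypic projectors, then `𝒮_k` has
dimension at least the number of charges on `k` sites. -/
lemma numIrreps_le_finrank_localCharges
    (h : ∀ a : Irreps u k → ℝ,
      chargeVector u (k + m) (tensOne d k m (∑ ν, (a ν : ℂ) • isotypicMat u k ν)) = 0 → a = 0) :
    numIrreps u k ≤ Module.finrank ℝ (localCharges u k m) := by
  let v : Irreps u k → localCharges u k m := fun ν =>
    ⟨_, isotypicMat u k ν, ⟨projMat_isHermitian, isInvariant_isotypicMat ν⟩, rfl⟩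
  have hv : LinearIndependent ℝ v := by
    rw [Fintype.linearIndependent_iff]
    intro a ha
    refine congrFun (h a ?_)
    have h2 := congrArg Subtype.val ha
    rw [Submodule.coe_sum] at h2
    rw [map_sum, map_sum]
    refine Eq.trans (Finset.sum_congr rfl fun ν _ => ?_) h2
    rw [map_smul, map_smul, Complex.coe_smul]
    rfl
  rw [numIrreps_eq_card]
  exact hv.fintype_card_le_finrank

lemma tensOne_zero (A : Op d n) : tensOne d n 0 A = A := by
  ext x y
  rw [tensOne_apply, tens_apply, Subsingleton.elim (fun i => x (Fin.natAdd n i))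
    (fun i => y (Fin.natAdd n i)), Matrix.one_apply_eq, mul_one]
  rfl

lemma chargeVector_isotypicMat_sum (a : Irreps u n → ℂ) (μ : Irreps u n) :
    chargeVector u n (∑ ν, a ν • isotypicMat u n ν) μ = a μ * (isotypicMat u n μ).trace := by
  rw [chargeVector_apply, Finset.mul_sum, Finset.sum_eq_single μ, mul_smul_comm,
    isotypicMat_mul_self, Matrix.trace_smul, smul_eq_mul]
  · intro ν _ h
    rw [mul_smul_comm, isotypicMat_mul_of_ne h.symm, smul_zero]
  · simp

theorem finrank_chargeSpace_self : Module.finrank ℝ (chargeSpace u n n) = numIrreps u n := by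
  have h : Module.finrank ℝ (chargeSpace u (n + 0) n) = numIrreps u n := by
    rw [chargeSpace_eq_localCharges]
    refine le_antisymm finrank_localCharges_le (numIrreps_le_finrank_localCharges fun a ha => ?_)
    ext ν
    have h0 : chargeVector u n (∑ ν, (a ν : ℂ) • isotypicMat u n ν) ν = 0 := by
      rw [← tensOne_zero (∑ ν, (a ν : ℂ) • isotypicMat u n ν)]
      exact congrFun ha ν
    rw [chargeVector_isotypicMat_sum] at h0
    simpa [trace_isotypicMat_ne_zero ν] using h0
  exact h

end Charges

/-- Rank-nullity for a linear map on a pair of nested subspaces. -/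
lemma finrank_add_finrank_map_le {K V W : Type*} [Field K] [AddCommGroup V] [Module K V]
    [FiniteDimensional K V] [AddCommGroup W] [Module K W] (f : V →ₗ[K] W) {p q : Submodule K V}
    (h : p ≤ q) :
    Module.finrank K p + Module.finrank K (q.map f) ≤
      Module.finrank K q + Module.finrank K (p.map f) := by
  have key : ∀ r : Submodule K V, Module.finrank K (r.map f) +
      Module.finrank K (r ⊓ LinearMap.ker f : Submodule K V) = Module.finrank K r := by
    intro r
    have h1 := LinearMap.finrank_range_add_finrank_ker (f.domRestrict r)
    rw [LinearMap.range_domRestrict, LinearMap.ker_domRestrict] at h1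
    rw [← h1, ← Submodule.map_comap_subtype, Submodule.finrank_map_subtype_eq]
  have h2 : Module.finrank K (p ⊓ LinearMap.ker f : Submodule K V) ≤
      Module.finrank K (q ⊓ LinearMap.ker f : Submodule K V) :=
    Submodule.finrank_mono (inf_le_inf_right _ h)
  have := key p
  have := key q
  omega

lemma localLieAlgebra_mono {n k l : ℕ} (h : k ≤ l) :
    localLieAlgebra u n k ≤ localLieAlgebra u n l :=
  LieSubalgebra.lieSpan_mono fun _ ⟨⟨S, hS, hA⟩, h'⟩ => ⟨⟨S, hS.trans h, hA⟩, h'⟩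

lemma finrank_localLieAlgebra_sub {n k l : ℕ} (h : k ≤ l) :
    (Module.finrank ℝ (localLieAlgebra u n l) : ℤ) - Module.finrank ℝ (localLieAlgebra u n k) ≥
      (Module.finrank ℝ (chargeSpace u n l) : ℤ) - Module.finrank ℝ (chargeSpace u n k) := by
  have := finrank_add_finrank_map_le (chargeMap u n)
    (LieSubalgebra.toSubmodule_le_toSubmodule _ _ |>.mpr (localLieAlgebra_mono (u := u) (n := n) h))
  rw [← chargeSpace_eq_map, ← chargeSpace_eq_map] at this
  have h1 : Module.finrank ℝ (localLieAlgebra u n l) =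
    Module.finrank ℝ (localLieAlgebra u n l).toSubmodule := rfl
  have h2 : Module.finrank ℝ (localLieAlgebra u n k) =
    Module.finrank ℝ (localLieAlgebra u n k).toSubmodule := rfl
  omega

/-! ### Determinants and exponentials of matrices -/

section MatrixAnalysis
variable {ι : Type*} [Fintype ι] [DecidableEq ι]

/-- The derivative of the determinant at the identity is the trace. -/
lemma hasDerivAt_det {γ : ℝ → Matrix ι ι ℂ} {X : Matrix ι ι ℂ} {t : ℝ} (h1 : γ t = 1)
    (h : ∀ x y, HasDerivAt (fun s => γ s x y) (X x y) t) :
    HasDerivAt (fun s => (γ s).det) X.trace t := by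
  have hsum : HasDerivAt (fun s => ∑ σ : Equiv.Perm ι, (Equiv.Perm.sign σ : ℤ) • ∏ i, γ s (σ i) i)
      (∑ σ : Equiv.Perm ι, (Equiv.Perm.sign σ : ℤ) •
        ∑ i, (∏ j ∈ Finset.univ.erase i, γ t (σ j) j) • X (σ i) i) t :=
    HasDerivAt.fun_sum fun σ _ =>
      (HasDerivAt.fun_finsetProd fun i _ => h (σ i) i).const_smul (Equiv.Perm.sign σ : ℤ)
  have hdet : (fun s => (γ s).det) =
      fun s => ∑ σ : Equiv.Perm ι, (Equiv.Perm.sign σ : ℤ) • ∏ i, γ s (σ i) i :=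
    funext fun s => Matrix.det_apply _
  rw [hdet]
  convert hsum using 1
  rw [Finset.sum_eq_single 1]
  · simp [h1, Matrix.trace]
  · -- a nontrivial permutation moves two points, so that its term has a double zero at `1`
    intro σ _ hσ
    rw [Finset.sum_eq_zero, smul_zero]
    intro i _
    have : ∃ j ∈ Finset.univ.erase i, σ j ≠ j := by
      by_contra! hfix
      refine hσ (Equiv.ext fun j => ?_)
      by_cases hj : j = i
      · subst hj
        by_contra hne
        have := hfix (σ j) (by simpa using hne)
        exact hne (σ.injective this)
      · exact hfix j (by simp [hj])
    obtain ⟨j, hj, hne⟩ := this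
    rw [Finset.prod_eq_zero hj (by rw [h1, Matrix.one_apply_ne hne]), zero_smul]
  · simp

open scoped Matrix.Norms.L2Operator

/-- Reading off a matrix entry, as a continuous linear map. -/
def entryCLM (x y : ι) : Matrix ι ι ℂ →L[ℝ] ℂ :=
  (Matrix.entryLinearMap ℝ ℂ x y).toContinuousLinearMap

lemma hasDerivAt_exp_entry (A : Matrix ι ι ℂ) (x y : ι) (t : ℝ) :
    HasDerivAt (fun s : ℝ => NormedSpace.exp (s • A) x y) ((NormedSpace.exp (t • A) * A) x y) t :=
  (entryCLM x y).hasFDerivAt.comp_hasDerivAt t (hasDerivAt_exp_smul_const A t)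

lemma contDiff_exp_entry (A : Matrix ι ι ℂ) (x y : ι) :
    ContDiff ℝ ∞ (fun s : ℝ => NormedSpace.exp (s • A) x y) := by
  have h1 : ContDiff ℝ ∞ (NormedSpace.exp : Matrix ι ι ℂ → Matrix ι ι ℂ) :=
    contDiff_iff_contDiffAt.mpr fun X => (NormedSpace.exp_analytic (𝕂 := ℝ) X).contDiffAt
  exact (entryCLM x y).contDiff.comp (h1.comp (contDiff_id.smul contDiff_const))

theorem det_exp (A : Matrix ι ι ℂ) : (NormedSpace.exp A).det = Complex.exp A.trace := by
  let φ : ℝ → ℂ := fun t => (NormedSpace.exp (t • A)).det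
  have hφ : ∀ t, HasDerivAt φ (φ t * A.trace) t := by
    intro t
    have h0 : HasDerivAt φ A.trace (t - t) := by
      rw [sub_self]
      refine hasDerivAt_det (by simp) fun x y => ?_
      simpa using hasDerivAt_exp_entry A x y 0
    have h1 : HasDerivAt (fun s => φ t * φ (s - t)) (φ t * A.trace) t :=
      (h0.comp_sub_const t t).const_mul _
    refine h1.congr_of_eventuallyEq (Filter.Eventually.of_forall fun s => ?_)
    simp only [φ]
    rw [← Matrix.det_mul, ← Matrix.exp_add_of_commute _ _
      (((Commute.refl A).smul_left _).smul_right _), ← add_smul, add_sub_cancel]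
  have hψ : ∀ t : ℝ, HasDerivAt (fun t : ℝ => φ t * Complex.exp (-(t * A.trace))) 0 t := by
    intro t
    have h1 : HasDerivAt (fun t : ℝ => Complex.exp (-((t : ℂ) * A.trace)))
        (Complex.exp (-(t * A.trace)) * -(1 * A.trace)) t :=
      (((Complex.ofRealCLM.hasDerivAt (x := t)).mul_const A.trace).fun_neg).cexp
    exact ((hφ t).fun_mul h1).congr_deriv (by ring)
  have hconst := is_const_of_deriv_eq_zero (fun t => (hψ t).differentiableAt)
    (fun t => (hψ t).deriv) 1 0
  simp only [φ, one_smul, zero_smul, NormedSpace.exp_zero, Matrix.det_one, Complex.ofReal_one,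
    Complex.ofReal_zero, one_mul, zero_mul, neg_zero, Complex.exp_zero, mul_one] at hconst
  rwa [Complex.exp_neg, mul_inv_eq_one₀ (Complex.exp_ne_zero _)] at hconst

lemma mul_exp_of_mul_eq_zero {P X : Matrix ι ι ℂ} (h : P * X = 0) :
    P * NormedSpace.exp X = P := by
  have h1 := (NormedSpace.exp_series_hasSum_exp' (𝕂 := ℂ) X).mul_left P
  refine h1.unique ?_
  have h2 := hasSum_single (f := fun n : ℕ => P * ((n.factorial⁻¹ : ℂ) • X ^ n)) 0 fun n hn => by
    obtain ⟨m, rfl⟩ := Nat.exists_eq_succ_of_ne_zero hn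
    rw [mul_smul_comm, pow_succ', ← mul_assoc, h, zero_mul, smul_zero]
  simpa using h2

/-- For a projector `P` commuting with `K`, the exponential of `P K` is `e^K` on the range of `P`
and the identity on its kernel. -/
lemma exp_projection_mul {P K : Matrix ι ι ℂ} (hP : P * P = P) (hK : K * P = P * K) :
    NormedSpace.exp (P * K) = P * NormedSpace.exp K + (1 - P) := by
  have hcomm : Commute (P * K) ((1 - P) * K) := by
    rw [Commute, SemiconjBy, sub_mul, one_mul, mul_sub, sub_mul]
    congr 1
    rw [← mul_assoc, hK]
  have h1 : NormedSpace.exp K = NormedSpace.exp (P * K) * NormedSpace.exp ((1 - P) * K) := by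
    rw [← Matrix.exp_add_of_commute _ _ hcomm]
    congr 1
    rw [sub_mul, one_mul, add_sub_cancel]
  have hcP : Commute P (P * K) := by
    rw [Commute, SemiconjBy, mul_assoc P K P, hK]
  have hcE : Commute P (NormedSpace.exp (P * K)) := hcP.exp_right
  have h2 : P * NormedSpace.exp ((1 - P) * K) = P :=
    mul_exp_of_mul_eq_zero (by rw [← mul_assoc, mul_sub, mul_one, hP, sub_self, zero_mul])
  have h3 : (1 - P) * NormedSpace.exp (P * K) = 1 - P :=
    mul_exp_of_mul_eq_zero (by rw [← mul_assoc, sub_mul, one_mul, hP, sub_self, zero_mul])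
  rw [h1, ← mul_assoc, hcE.eq, mul_assoc, h2]
  conv_rhs => rw [← h3, sub_mul, one_mul, hcE.eq]
  abel

/-- Every unitary matrix is `e^{iH}` with `H` Hermitian and in the double commutant of the
matrix. -/
lemma exists_hermitian_exp_eq {V : Matrix ι ι ℂ} (hV : V ∈ Matrix.unitaryGroup ι ℂ) :
    ∃ H : Matrix ι ι ℂ, H.IsHermitian ∧ NormedSpace.exp (Complex.I • H) = V ∧
      ∀ B : Matrix ι ι ℂ, V * B = B * V → Vᴴ * B = B * Vᴴ → H * B = B * H := by
  have hn : IsStarNormal V := ⟨by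
    rw [Commute, SemiconjBy, Matrix.mem_unitaryGroup_iff.mp hV, Matrix.mem_unitaryGroup_iff'.mp hV]⟩
  have hfin : (spectrum ℂ V).Finite := Matrix.finite_spectrum V
  have hc : ∀ f : ℂ → ℂ, ContinuousOn f (spectrum ℂ V) := fun f => hfin.continuousOn f
  refine ⟨cfc (fun z => (Complex.arg z : ℂ)) V, ?_, ?_, ?_⟩
  · have := cfc_star (fun z : ℂ => (Complex.arg z : ℂ)) V
    simp only [RCLike.star_def, Complex.conj_ofReal] at this
    exact this.symm
  · have hf := hc fun z : ℂ => (Complex.arg z : ℂ)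
    have hf' := hc fun z : ℂ => Complex.I • (Complex.arg z : ℂ)
    rw [← cfc_smul _ _ _ hf, ← CFC.complex_exp_eq_normedSpace_exp (cfc_predicate _ _),
      ← cfc_comp' _ _ _ Complex.continuous_exp.continuousOn hf']
    conv_rhs => rw [← cfc_id' ℂ V]
    refine cfc_congr fun z hz => ?_
    have hz1 : ‖z‖ = 1 := spectrum.norm_eq_one_of_unitary hV hz
    have := Complex.norm_mul_exp_arg_mul_I z
    rw [hz1, Complex.ofReal_one, one_mul] at this
    simpa [mul_comm] using this
  · intro B h1 h2
    exact Commute.cfc h1 h2 _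

end MatrixAnalysis

/-! ### Determinants on the charge sectors -/

section SectorDet
variable {k m n : ℕ}

variable (u n) in
/-- The determinant of the restriction of `V` to the isotypic component of `μ`, as the determinant
of the operator that is `V` on this component and the identity on its orthogonal complement. -/
def sectorDet (μ : Irreps u n) (V : Op d n) : ℂ :=
  (isotypicMat u n μ * V + (1 - isotypicMat u n μ)).det

lemma sectorDet_one (μ : Irreps u n) : sectorDet u n μ 1 = 1 := by
  simp [sectorDet]

lemma sectorDet_mul {V W : Op d n} (hV : IsInvariant u V) (μ : Irreps u n) :
    sectorDet u n μ (V * W) = sectorDet u n μ V * sectorDet u n μ W := by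
  rw [sectorDet, sectorDet, sectorDet, ← Matrix.det_mul]
  congr 1
  have h := isotypicMat_comm hV μ
  have hP := isotypicMat_mul_self μ
  set P := isotypicMat u n μ
  have h1 : P * V * P = P * V := by rw [mul_assoc, h, ← mul_assoc, hP]
  rw [add_mul, mul_add, mul_add, ← mul_assoc (P * V), h1, mul_sub, mul_one, h1, sub_self,
    add_zero, mul_assoc, ← mul_assoc (1 - P), sub_mul 1 P P, one_mul, hP, sub_self, zero_mul,
    zero_add, mul_sub, mul_one, sub_mul, one_mul, hP, sub_self, sub_zero]

lemma sectorDet_exp {K : Op d n} (hK : IsInvariant u K) (μ : Irreps u n) :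
    sectorDet u n μ (NormedSpace.exp K) = Complex.exp (chargeVector u n K μ) := by
  rw [sectorDet, ← exp_projection_mul (isotypicMat_mul_self μ) (isotypicMat_comm hK μ), det_exp,
    chargeVector_apply]

lemma sectorDet_permuteSites (π : Equiv.Perm (Fin n)) (μ : Irreps u n) (V : Op d n) :
    sectorDet u n μ (permuteSites π V) = sectorDet u n μ V := by
  have : isotypicMat u n μ * permuteSites π V + (1 - isotypicMat u n μ) =
      permuteSites π (isotypicMat u n μ * V + (1 - isotypicMat u n μ)) := by
    rw [map_add, map_sub, map_mul, map_one, permuteSites_isotypicMat]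
  rw [sectorDet, this]
  exact Matrix.det_reindexAlgEquiv ℂ ℂ _ _

lemma continuous_tensOne : Continuous (tensOne d k m) :=
  (tensOne d k m).toLinearMap.continuous_of_finiteDimensional

lemma tensOne_exp (A : Op d k) :
    tensOne d k m (NormedSpace.exp A) = NormedSpace.exp (tensOne d k m A) := by
  open scoped Matrix.Norms.L2Operator in
  let _ : NormedAlgebra ℚ (Op d k) := NormedAlgebra.restrictScalars ℚ ℂ (Op d k)
  exact NormedSpace.map_exp (tensOne d k m) continuous_tensOne A

lemma localSymmetricUnitaries_le_symmetricUnitaries :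
    localSymmetricUnitaries u n k ≤ symmetricUnitaries u n := by
  rw [localSymmetricUnitaries, Subgroup.closure_le]
  rintro V ⟨_, hV⟩
  rw [SetLike.mem_coe, symmetricUnitaries, Subgroup.mem_centralizer_iff]
  rintro _ ⟨g, rfl⟩
  exact Subtype.ext (hV g).symm

lemma isInvariant_of_mem_localSymmetricUnitaries {V : UnitaryOp d n}
    (hV : V ∈ localSymmetricUnitaries u n k) : IsInvariant u (V : Op d n) := by
  intro g
  have := Subgroup.mem_centralizer_iff.mp (localSymmetricUnitaries_le_symmetricUnitaries hV)
    (tensorRep u n g) ⟨g, rfl⟩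
  exact congrArg Subtype.val this.symm

/-- The sector determinants of a product of local invariant unitaries are the exponentials of a
vector in `𝒮_k`. -/
lemma exists_sectorDet_eq {V : UnitaryOp d (k + m)}
    (hV : V ∈ localSymmetricUnitaries u (k + m) k) :
    ∃ s ∈ localCharges u k m, ∀ μ, sectorDet u (k + m) μ V = Complex.exp (Complex.I * s μ) := by
  induction hV using Subgroup.closure_induction with
  | mem V hV =>
    rcases isEmpty_or_nonempty (Conf d m) with hm | hm
    · have : IsEmpty (Conf d (k + m)) := ⟨fun x => hm.elim fun i => x (Fin.natAdd k i)⟩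
      exact ⟨0, Submodule.zero_mem _, fun μ => by simp [sectorDet]⟩
    obtain ⟨hloc, hinv⟩ := hV
    obtain ⟨π, A, hA⟩ := hloc.exists_permuteSites_eq
    have hAinv : IsInvariant u A := isInvariant_of_tensOne (hA ▸ hinv.permuteSites π)
    have hAu : A ∈ Matrix.unitaryGroup (Conf d k) ℂ := by
      rw [Matrix.mem_unitaryGroup_iff, Matrix.star_eq_conjTranspose]
      apply tensOne_injective (m := m)
      rw [map_mul, ← conjTranspose_tensOne, ← hA, permuteSites_conjTranspose, ← map_mul,
        ← Matrix.star_eq_conjTranspose, Matrix.mem_unitaryGroup_iff.mp V.2, map_one, map_one]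
    obtain ⟨H, hH, hexp, hcomm⟩ := exists_hermitian_exp_eq hAu
    have hHinv : IsInvariant u H := fun g => hcomm _ (hAinv g) (hAinv.conjTranspose g)
    refine ⟨_, ⟨H, ⟨hH, hHinv⟩, rfl⟩, fun μ => ?_⟩
    rw [← sectorDet_permuteSites π, hA, ← hexp, tensOne_exp, sectorDet_exp (hHinv.smul _).tensOne,
      map_smul, map_smul]
    rfl
  | one => exact ⟨0, Submodule.zero_mem _, fun μ => by simp [sectorDet_one]⟩
  | mul V W hV hW ihV ihW =>
    obtain ⟨s, hs, hsV⟩ := ihV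
    obtain ⟨t, ht, htW⟩ := ihW
    refine ⟨s + t, Submodule.add_mem _ hs ht, fun μ => ?_⟩
    rw [Submonoid.coe_mul, sectorDet_mul (isInvariant_of_mem_localSymmetricUnitaries hV), hsV, htW,
      ← Complex.exp_add, Pi.add_apply, mul_add]
  | inv V hV ih =>
    obtain ⟨s, hs, hsV⟩ := ih
    refine ⟨-s, Submodule.neg_mem _ hs, fun μ => ?_⟩
    have h1 : sectorDet u (k + m) μ (V : Op d (k + m)) *
        sectorDet u (k + m) μ ((V⁻¹ : UnitaryOp d (k + m)) : Op d (k + m)) = 1 := by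
      rw [← sectorDet_mul (isInvariant_of_mem_localSymmetricUnitaries hV), ← Submonoid.coe_mul,
        mul_inv_cancel, Submonoid.coe_one, sectorDet_one]
    rw [Pi.neg_apply, mul_neg, Complex.exp_neg, ← hsV]
    exact eq_inv_of_mul_eq_one_right h1

end SectorDet

/-! ### Tangent vectors -/

section Tangent
variable {k m n : ℕ}

lemma hasDerivAt_sectorDet {γ : ℝ → Op d n} {X : Op d n} (h0 : γ 0 = 1)
    (hX : ∀ x y, HasDerivAt (fun t => γ t x y) (X x y) 0) (μ : Irreps u n) :
    HasDerivAt (fun t => sectorDet u n μ (γ t)) (chargeVector u n X μ) 0 := by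
  rw [chargeVector_apply]
  refine hasDerivAt_det (by simp [h0]) fun x y => ?_
  simp only [Matrix.add_apply, Matrix.mul_apply]
  exact (HasDerivAt.fun_sum fun z _ => (hX z y).const_mul _).add_const _

/-- A continuous curve on an interval that stays in a subspace up to a countable set lies in the
subspace if it starts there: a linear functional that vanishes on the subspace maps the curve to a
countable connected set, hence to a point. -/
lemma mem_of_continuousOn_of_countable {E : Type*} [NormedAddCommGroup E] [NormedSpace ℝ E]
    [FiniteDimensional ℝ E] (S : Submodule ℝ E) {Z : Set E} (hZ : Z.Countable) {c : ℝ → E}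
    {I : Set ℝ} (hI : IsPreconnected I) (hc : ContinuousOn c I)
    (h : ∀ t ∈ I, ∃ s ∈ S, c t - s ∈ Z) {t₀ : ℝ} (ht₀ : t₀ ∈ I) (h₀ : c t₀ ∈ S) {t : ℝ}
    (ht : t ∈ I) : c t ∈ S := by
  by_contra hn
  obtain ⟨f, hf, hS⟩ := Submodule.exists_le_ker_of_notMem hn
  have hfc : Continuous f := f.continuous_of_finiteDimensional
  have hsub : (fun t => f (c t)) '' I ⊆ f '' Z := by
    rintro _ ⟨t, ht, rfl⟩
    obtain ⟨s, hs, hz⟩ := h t ht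
    refine ⟨_, hz, ?_⟩
    rw [map_sub, LinearMap.mem_ker.mp (hS hs), sub_zero]
  have hpre := hI.image _ (hfc.comp_continuousOn hc)
  have := (hZ.image f).isTotallyDisconnected _ hsub hpre ⟨t, ht, rfl⟩ ⟨t₀, ht₀, rfl⟩
  dsimp only at this
  rw [LinearMap.mem_ker.mp (hS h₀)] at this
  exact hf this

/-- The charges of the tangent vectors of `𝒱_k` lie in `𝒮_k`: along a curve in `𝒱_k`, the
logarithms of the sector determinants stay in `i 𝒮_k` up to the countable group `2πi ℤ`. -/
theorem chargeMap_mem_of_mem_tangentVectors {X : Op d (k + m)}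
    (hX : X ∈ tangentVectors (localSymmetricUnitaries u (k + m) k)) :
    chargeMap u (k + m) X ∈ localCharges u k m := by
  obtain ⟨γ, hγ, h0, hsm, hder⟩ := hX
  have h0' : (γ 0 : Op d (k + m)) = 1 := by rw [h0]; rfl
  let D : ℝ → Irreps u (k + m) → ℂ := fun t μ => sectorDet u (k + m) μ (γ t)
  have hDder : ∀ μ, HasDerivAt (fun t => D t μ) (chargeVector u (k + m) X μ) 0 :=
    fun μ => hasDerivAt_sectorDet h0' hder μ
  have hD0 : ∀ μ, D 0 μ = 1 := fun μ => by simp only [D]; rw [h0', sectorDet_one]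
  have hγc : Continuous fun t => (γ t : Op d (k + m)) :=
    continuous_matrix fun x y => (hsm x y).continuous
  have hDc : ∀ μ, Continuous fun t => D t μ := fun μ =>
    ((continuous_const.matrix_mul hγc).add continuous_const).matrix_det
  have hev : ∀ᶠ t in nhds (0 : ℝ), ∀ μ, D t μ ∈ Complex.slitPlane := by
    rw [Filter.eventually_all]
    intro μ
    refine (hDc μ).continuousAt.eventually_mem (Complex.isOpen_slitPlane.mem_nhds ?_)
    rw [hD0]; exact Complex.one_mem_slitPlane
  obtain ⟨ε, hε, hball⟩ := Metric.eventually_nhds_iff_ball.mp hev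
  -- the curve `-i log D`, which starts at the origin
  let c : ℝ → Irreps u (k + m) → ℂ := fun t μ => -Complex.I * Complex.log (D t μ)
  have hcder : HasDerivAt c (chargeMap u (k + m) X) 0 := by
    rw [hasDerivAt_pi]
    intro μ
    have := (hDder μ).clog_real (by rw [hD0]; exact Complex.one_mem_slitPlane)
    rw [hD0, div_one] at this
    exact this.const_mul _
  let Z : Set (Irreps u (k + m) → ℂ) :=
    Set.range fun (z : Irreps u (k + m) → ℤ) μ => (z μ : ℂ) * (2 * Real.pi)
  have hmem : ∀ t ∈ Metric.ball (0 : ℝ) ε, c t ∈ localCharges u k m := by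
    intro t ht
    refine mem_of_continuousOn_of_countable (localCharges u k m) (Z := Z)
      (Set.countable_range _) (convex_ball (0 : ℝ) ε).isPreconnected ?_ ?_
      (Metric.mem_ball_self hε) ?_ ht
    · exact continuousOn_pi.mpr fun μ => continuousOn_const.mul
        (ContinuousOn.clog (hDc μ).continuousOn fun t ht => hball t ht μ)
    · intro t ht
      obtain ⟨s, hs, hsV⟩ := exists_sectorDet_eq (hγ t)
      have : ∀ μ, ∃ z : ℤ, c t μ - s μ = (z : ℂ) * (2 * Real.pi) := by
        intro μ
        have h1 : Complex.exp (Complex.log (D t μ)) = Complex.exp (Complex.I * s μ) := by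
          rw [Complex.exp_log (Complex.slitPlane_ne_zero (hball t ht μ))]
          exact hsV μ
        obtain ⟨z, hz⟩ := Complex.exp_eq_exp_iff_exists_int.mp h1
        refine ⟨z, ?_⟩
        simp only [c]
        rw [hz]
        linear_combination (-(s μ) - z * (2 * Real.pi)) * Complex.I_mul_I
      choose z hz using this
      exact ⟨s, hs, z, (funext hz).symm⟩
    · have : c 0 = 0 := by ext μ; simp [c, hD0]
      rw [this]; exact Submodule.zero_mem _
  have hclosed : IsClosed (localCharges u k m : Set (Irreps u (k + m) → ℂ)) :=
    Submodule.closed_of_finiteDimensional _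
  -- the derivative is the limit of the difference quotients, which lie in the subspace
  have hlim := hasDerivAt_iff_tendsto_slope_zero.mp hcder
  refine hclosed.mem_of_tendsto hlim (Filter.Eventually.filter_mono nhdsWithin_le_nhds ?_)
  filter_upwards [Metric.ball_mem_nhds (0 : ℝ) hε] with t ht
  rw [zero_add]
  exact Submodule.smul_mem _ _ (Submodule.sub_mem _ (hmem t ht) (hmem 0 (Metric.mem_ball_self hε)))

/-- A one-parameter group in `V` is a curve that witnesses its generator as a tangent vector. -/
lemma mem_tangentVectors_of_exp_mem {V : Subgroup (UnitaryOp d n)} {X : Op d n}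
    (h : ∀ t : ℝ, ∃ W ∈ V, (W : Op d n) = NormedSpace.exp (t • X)) : X ∈ tangentVectors V := by
  choose γ hγ hexp using h
  refine ⟨γ, hγ, Subtype.ext ?_, fun x y => ?_, fun x y => ?_⟩
  · rw [hexp, zero_smul, NormedSpace.exp_zero]; rfl
  · simp only [hexp]
    exact contDiff_exp_entry X x y
  · simp only [hexp]
    simpa using hasDerivAt_exp_entry X x y 0

lemma exp_neg_I_smul_mem_unitaryGroup {H : Op d n} (hH : H.IsHermitian) (t : ℝ) :
    NormedSpace.exp (t • -Complex.I • H) ∈ Matrix.unitaryGroup (Conf d n) ℂ := by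
  rw [Matrix.mem_unitaryGroup_iff, Matrix.star_eq_conjTranspose, ← Matrix.exp_conjTranspose]
  have : (t • -Complex.I • H)ᴴ = -(t • -Complex.I • H) := by
    simp [Matrix.conjTranspose_smul, hH.eq]
  rw [this, ← Matrix.exp_add_of_commute _ _ (Commute.refl (t • -Complex.I • H)).neg_right,
    add_neg_cancel, NormedSpace.exp_zero]

lemma IsInvariant.exp {A : Op d n} (hA : IsInvariant u A) :
    IsInvariant u (NormedSpace.exp A) := fun g => by
  have : Commute (tensorRep u n g : Op d n) A := (hA g).symm
  exact (this.exp_right).eq.symm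

/-- A Hermitian invariant operator on the first `k` sites generates a one-parameter group in
`𝒱_k`. -/
lemma exists_mem_localSymmetricUnitaries_exp {H : Op d k} (hH : H ∈ invariantHermitian u k)
    (t : ℝ) : ∃ V ∈ localSymmetricUnitaries u (k + m) k,
      (V : Op d (k + m)) = NormedSpace.exp (t • -Complex.I • tensOne d k m H) := by
  have hherm : (tensOne d k m H).IsHermitian := by
    rw [Matrix.IsHermitian, conjTranspose_tensOne, hH.1.eq]
  have hinv : IsInvariant u (t • -Complex.I • tensOne d k m H) := by
    rw [← Complex.coe_smul]
    exact (hH.2.tensOne.smul _).smul _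
  refine ⟨⟨_, exp_neg_I_smul_mem_unitaryGroup hherm t⟩, Subgroup.subset_closure ⟨?_, hinv.exp⟩, rfl⟩
  have : NormedSpace.exp (t • -Complex.I • tensOne d k m H) =
      tensOne d k m (NormedSpace.exp ((t : ℂ) • -Complex.I • H)) := by
    rw [tensOne_exp, map_smul, map_smul, Complex.coe_smul]
  change IsLocal k (NormedSpace.exp (t • -Complex.I • tensOne d k m H))
  rw [this]
  exact isLocal_tensOne _

lemma tangentVectors_mono {V W : Subgroup (UnitaryOp d n)} (h : V ≤ W) :
    tangentVectors V ⊆ tangentVectors W :=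
  fun _ ⟨γ, hγ, h'⟩ => ⟨γ, fun t => h (hγ t), h'⟩

theorem finrank_chargeSpace_le (h : k ≤ n) :
    Module.finrank ℝ (chargeSpace u n k) ≤ numIrreps u k := by
  obtain ⟨m, rfl⟩ := Nat.exists_eq_add_of_le h
  rw [chargeSpace_eq_localCharges]
  exact finrank_localCharges_le

/-- The tangent space of `𝒱_k` has the same charges as `𝔥_k`. -/
theorem map_span_tangentVectors_eq (h : k ≤ n) :
    (Submodule.span ℝ (tangentVectors (localSymmetricUnitaries u n k))).map (chargeMap u n) =
      chargeSpace u n k := by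
  obtain ⟨m, rfl⟩ := Nat.exists_eq_add_of_le h
  rw [chargeSpace_eq_localCharges]
  apply le_antisymm
  · rw [Submodule.map_span_le]
    exact fun X hX => chargeMap_mem_of_mem_tangentVectors hX
  · rintro _ ⟨H, hH, rfl⟩
    refine ⟨-Complex.I • tensOne d k m (-H), Submodule.subset_span
      (mem_tangentVectors_of_exp_mem fun t =>
        exists_mem_localSymmetricUnitaries_exp (Submodule.neg_mem _ hH) t), ?_⟩
    rw [chargeMap_apply, smul_smul]
    simp

/-- The vectors of `𝒮_k` are the charge vectors of the generators of the one-parameter groups in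
`𝒱_k`. -/
theorem coe_chargeSpace_eq (h : k ≤ n) :
    (chargeSpace u n k : Set (Irreps u n → ℂ)) =
      {χ | ∃ H : Op d n, H.IsHermitian ∧
        (∀ t : ℝ, ∃ V ∈ localSymmetricUnitaries u n k,
          (V : Op d n) = NormedSpace.exp ((-(Complex.I * (t : ℂ))) • H)) ∧
        chargeVector u n H = χ} := by
  obtain ⟨m, rfl⟩ := Nat.exists_eq_add_of_le h
  have hsmul : ∀ (t : ℝ) (H : Op d (k + m)),
      (-(Complex.I * (t : ℂ))) • H = t • -Complex.I • H := fun t H => by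
    rw [← Complex.coe_smul, smul_smul]
    congr 1
    ring
  ext χ
  rw [SetLike.mem_coe, Set.mem_ofPred_eq]
  constructor
  · rw [chargeSpace_eq_localCharges]
    rintro ⟨H, hH, rfl⟩
    refine ⟨tensOne d k m H, ?_, fun t => ?_, rfl⟩
    · rw [Matrix.IsHermitian, conjTranspose_tensOne, hH.1.eq]
    · rw [hsmul]
      exact exists_mem_localSymmetricUnitaries_exp hH t
  · rintro ⟨H, -, hexp, rfl⟩
    rw [← map_span_tangentVectors_eq h]
    have hX : -Complex.I • H ∈ tangentVectors (localSymmetricUnitaries u (k + m) k) :=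
      mem_tangentVectors_of_exp_mem fun t => by rw [← hsmul]; exact hexp t
    have := Submodule.neg_mem _ (Submodule.mem_map_of_mem (f := chargeMap u (k + m))
      (Submodule.subset_span hX))
    rw [chargeMap_apply, smul_smul] at this
    simpa using this

/-- A group of unitaries that contains `𝒱_l` exceeds `𝒱_k` in dimension at least by as much as
`𝒮_l` exceeds `𝒮_k`. -/
theorem groupDim_sub_ge {l : ℕ} {V : Subgroup (UnitaryOp d n)} (hk : k ≤ n) (hl : l ≤ n)
    (hkV : localSymmetricUnitaries u n k ≤ V) (hlV : localSymmetricUnitaries u n l ≤ V) :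
    (groupDim V : ℤ) - groupDim (localSymmetricUnitaries u n k) ≥
      (Module.finrank ℝ (chargeSpace u n l) : ℤ) - Module.finrank ℝ (chargeSpace u n k) := by
  have h1 := finrank_add_finrank_map_le (chargeMap u n)
    (Submodule.span_mono (R := ℝ) (tangentVectors_mono hkV))
  have h2 : chargeSpace u n l ≤ (Submodule.span ℝ (tangentVectors V)).map (chargeMap u n) := by
    rw [← map_span_tangentVectors_eq hl]
    exact Submodule.map_mono (Submodule.span_mono (tangentVectors_mono hlV))
  have h3 := Submodule.finrank_mono h2
  rw [map_span_tangentVectors_eq hk] at h1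
  rw [groupDim, groupDim]
  omega

lemma localSymmetricUnitaries_mono {l : ℕ} (h : k ≤ l) :
    localSymmetricUnitaries u n k ≤ localSymmetricUnitaries u n l :=
  Subgroup.closure_mono fun _ ⟨⟨S, hS, hA⟩, h'⟩ => ⟨⟨S, hS.trans h, hA⟩, h'⟩

end Tangent

/-! ### Connected groups -/

section Connected
variable {k m n : ℕ}

/-- An invariant operator without charges is orthogonal to all `U(g)`, because `A ↦ Tr (A U(g))` is
tracial. -/
lemma trace_mul_tensorRep_eq_zero {A : Op d n} (hA : IsInvariant u A)
    (h : chargeVector u n A = 0) (g : G) : (A * (tensorRep u n g : Op d n)).trace = 0 := by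
  have htr : IsTracial u (Matrix.traceLinearMap (Conf d n) ℂ ℂ ∘ₗ
      LinearMap.mulRight ℂ (tensorRep u n g : Op d n)) := by
    intro B C hB hC
    change (B * C * _).trace = (C * B * _).trace
    rw [mul_assoc, hC g, ← mul_assoc, Matrix.trace_mul_comm, ← mul_assoc]
  obtain ⟨w, hw⟩ := htr.exists_weights
  have := hw A hA
  simp only [h, Pi.zero_apply, mul_zero, Finset.sum_const_zero] at this
  exact this

lemma trace_tens_mul_tensorRep (A : Op d k) (B : Op d m) (g : G) :
    (tens A B * (tensorRep u (k + m) g : Op d (k + m))).trace =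
      (A * (tensorRep u k g : Op d k)).trace * (B * (tensorRep u m g : Op d m)).trace := by
  rw [tensorRep_add, tens_mul, trace_tens]

variable [TopologicalSpace G]

lemma continuous_tensorRep (hu : Continuous u) :
    Continuous fun g => (tensorRep u n g : Op d n) := by
  refine continuous_matrix fun x y => ?_
  change Continuous fun g => ∏ i, (u g : Matrix (Fin d) (Fin d) ℂ) (x i) (y i)
  exact continuous_finsetProd _ fun i _ =>
    (continuous_subtype_val.comp hu).matrix_elem (x i) (y i)

variable [IsTopologicalGroup G] [ConnectedSpace G]

lemma subgroup_eq_top_of_eventually (H : Subgroup G) (h : ∀ᶠ g in nhds (1 : G), g ∈ H) :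
    H = ⊤ := by
  have ho : IsOpen (H : Set G) := H.isOpen_of_mem_nhds (g := 1) h
  exact SetLike.coe_injective (IsClopen.eq_univ ⟨H.isClosed_of_isOpen ho, ho⟩ ⟨1, H.one_mem⟩)

/-- Unique continuation for matrix coefficients: a matrix coefficient of a connected group that
vanishes near the identity vanishes everywhere. The coefficients `Tr (M U(·))` vanishing near the
identity form a finite-dimensional space, so they all vanish on a common neighbourhood; hence
translations by small elements, and then by all elements, preserve this space. -/
theorem trace_mul_tensorRep_eq_zero_of_eventually {M : Op d n}
    (hM : ∀ᶠ g in nhds (1 : G), (M * (tensorRep u n g : Op d n)).trace = 0) (g : G) :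
    (M * (tensorRep u n g : Op d n)).trace = 0 := by
  let V : Submodule ℂ (Op d n) :=
    { carrier := {M | ∀ᶠ g in nhds (1 : G), (M * (tensorRep u n g : Op d n)).trace = 0}
      zero_mem' := by simp
      add_mem' := fun hA hB => by
        filter_upwards [hA, hB] with g h1 h2
        rw [add_mul, Matrix.trace_add, h1, h2, add_zero]
      smul_mem' := fun c A hA => by
        filter_upwards [hA] with g h1
        rw [smul_mul_assoc, Matrix.trace_smul, h1, smul_zero] }
  have hV : ∀ᶠ g in nhds (1 : G), ∀ M ∈ V, (M * (tensorRep u n g : Op d n)).trace = 0 := by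
    obtain ⟨s, hs⟩ := IsNoetherian.noetherian V
    have h1 : ∀ᶠ g in nhds (1 : G), ∀ M ∈ s, (M * (tensorRep u n g : Op d n)).trace = 0 :=
      (Filter.eventually_all_finset s).mpr fun M hM => by
        have : M ∈ V := hs ▸ Submodule.subset_span hM
        exact this
    filter_upwards [h1] with g hg M hM
    rw [← hs] at hM
    induction hM using Submodule.span_induction with
    | mem M hM => exact hg M hM
    | zero => simp
    | add A B _ _ hA hB => rw [add_mul, Matrix.trace_add, hA, hB, add_zero]
    | smul c A _ hA => rw [smul_mul_assoc, Matrix.trace_smul, hA, smul_zero]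
  obtain ⟨N, hN, hNo, hN1⟩ := eventually_nhds_iff.mp hV
  have hstable : ∀ h ∈ N, ∀ M ∈ V, M * (tensorRep u n h : Op d n) ∈ V := by
    intro h hh M hM
    have : ∀ᶠ g in nhds (1 : G), h * g ∈ N :=
      (continuous_const_mul h).continuousAt.eventually_mem
        (hNo.mem_nhds (by rwa [mul_one]))
    change ∀ᶠ g in nhds (1 : G), _
    filter_upwards [this] with g hg
    rw [mul_assoc, ← Submonoid.coe_mul, ← map_mul]
    exact hN _ hg M hM
  have hcancel : ∀ (M : Op d n) (h h' : G), M * (tensorRep u n h : Op d n) *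
      (tensorRep u n h' : Op d n) = M * (tensorRep u n (h * h') : Op d n) := fun M h h' => by
    rw [mul_assoc, ← Submonoid.coe_mul, ← map_mul]
  let H : Subgroup G :=
    { carrier := {h | ∀ M, M ∈ V ↔ M * (tensorRep u n h : Op d n) ∈ V}
      one_mem' := fun M => by simp
      mul_mem' := fun {a b} ha hb M => by rw [ha M, hb _, hcancel]
      inv_mem' := fun {a} ha M => by
        rw [ha (M * _), hcancel, inv_mul_cancel, map_one, Submonoid.coe_one, mul_one] }
  have hH : H = ⊤ := by
    apply subgroup_eq_top_of_eventually
    have h1 : ∀ᶠ g in nhds (1 : G), g ∈ N := hNo.mem_nhds hN1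
    have h2 : ∀ᶠ g in nhds (1 : G), g⁻¹ ∈ N :=
      continuous_inv.continuousAt.eventually_mem (hNo.mem_nhds (by rwa [inv_one]))
    filter_upwards [h1, h2] with g hg hg' M
    refine ⟨hstable g hg M, fun h => ?_⟩
    have := hstable _ hg' _ h
    rwa [hcancel, mul_inv_cancel, map_one, Submonoid.coe_one, mul_one] at this
  have hmem : M * (tensorRep u n g : Op d n) ∈ V :=
    ((hH ▸ Subgroup.mem_top g : g ∈ H) M).mp hM
  have := Filter.Eventually.self_of_nhds hmem
  rwa [map_one, Submonoid.coe_one, mul_one] at this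

/-- For a connected group and `k ≥ 1`, the dimension of `𝒮_k` is the number of charges on `k`
sites. -/
theorem finrank_chargeSpace_eq (hu : Continuous u) (hk : 1 ≤ k) (h : k ≤ n) :
    Module.finrank ℝ (chargeSpace u n k) = numIrreps u k := by
  refine le_antisymm (finrank_chargeSpace_le h) ?_
  obtain ⟨m, rfl⟩ := Nat.exists_eq_add_of_le h
  rw [chargeSpace_eq_localCharges]
  refine numIrreps_le_finrank_localCharges fun a ha => ?_
  ext ν
  rcases isEmpty_or_nonempty (Conf d m) with hm | hm
  · have : IsEmpty (Conf d k) := ⟨fun x => hm.elim fun _ => x ⟨0, hk⟩⟩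
    exact absurd (by simp [Matrix.trace]) (trace_isotypicMat_ne_zero ν)
  set A := ∑ ν, (a ν : ℂ) • isotypicMat u k ν with hA
  have hAinv : IsInvariant u A :=
    isInvariant_sum _ _ fun ν _ => (isInvariant_isotypicMat ν).smul _
  have h0 : ∀ g, (A * (tensorRep u k g : Op d k)).trace *
      (tensorRep u m g : Op d m).trace = 0 := fun g => by
    have := trace_mul_tensorRep_eq_zero hAinv.tensOne ha g
    rwa [tensOne_apply, trace_tens_mul_tensorRep, one_mul] at this
  have hne : ∀ᶠ g in nhds (1 : G), (tensorRep u m g : Op d m).trace ≠ 0 := by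
    refine (continuous_tensorRep hu).matrix_trace.continuousAt.eventually_ne ?_
    rw [map_one, Submonoid.coe_one, Matrix.trace_one, Nat.cast_ne_zero]
    exact Fintype.card_ne_zero
  have hzero := trace_mul_isotypicMat_eq_zero (M := A)
    (trace_mul_tensorRep_eq_zero_of_eventually (by
      filter_upwards [hne] with g hg
      exact (mul_eq_zero.mp (h0 g)).resolve_right hg)) ν
  rw [Matrix.trace_mul_comm, ← chargeVector_apply, hA, chargeVector_isotypicMat_sum] at hzero
  simpa [trace_isotypicMat_ne_zero ν] using hzero

end Connected

/-! ### Growth of the number of charges -/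

section Growth
variable {n : ℕ}

/-- A unitary matrix close to a scalar matrix is scalar as soon as `d Tr(V²) = (Tr V)²`. With
`V₀ = V - t` the traceless part, this says that `Tr(V₀²) = 0`, and then unitarity gives
`Tr(V₀† V₀ V₀) = - t Tr(V₀† V₀)`, where the left side is of third order in `V₀`. -/
lemma eq_smul_one_of_trace_sq {V : Matrix (Fin d) (Fin d) ℂ}
    (hV : V ∈ Matrix.unitaryGroup (Fin d) ℂ) {t : ℂ} (ht : V.trace = d * t)
    (hsq : (V * V).trace = d * t ^ 2) {δ : ℝ} (hδ : ∀ i j, ‖(V - t • 1) i j‖ ≤ δ)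
    (hlt : d * δ < ‖t‖) : V = t • 1 := by
  set W : Matrix (Fin d) (Fin d) ℂ := V - t • 1 with hW
  have hVW : V = W + t • 1 := by rw [hW, sub_add_cancel]
  have hW1 : W.trace = 0 := by
    rw [hW, Matrix.trace_sub, ht, Matrix.trace_smul, Matrix.trace_one, Fintype.card_fin,
      smul_eq_mul, mul_comm, sub_self]
  have hW2 : (W * W).trace = 0 := by
    have : W * W = V * V - (2 * t) • V + (t ^ 2) • 1 := by
      rw [hW, sub_mul, mul_sub, mul_sub]
      simp only [Matrix.smul_mul, Matrix.mul_smul, one_mul, mul_one, smul_smul, two_mul, add_smul,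
        sq]
      abel
    rw [this, Matrix.trace_add, Matrix.trace_sub, hsq, Matrix.trace_smul, ht, Matrix.trace_smul,
      Matrix.trace_one, Fintype.card_fin, smul_eq_mul, smul_eq_mul]
    ring
  let N : ℝ := ∑ i, ∑ j, ‖W i j‖ ^ 2
  have hN : (Wᴴ * W).trace = N := by
    simp only [Matrix.trace, Matrix.diag, Matrix.mul_apply, Matrix.conjTranspose_apply, N]
    rw [Finset.sum_comm]
    push_cast
    refine Finset.sum_congr rfl fun i _ => Finset.sum_congr rfl fun j _ => ?_
    rw [RCLike.star_def, Complex.conj_mul']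
  have hcubic : (Wᴴ * W * W).trace = -t * N := by
    have h1 : Vᴴ * V * W = W := by
      rw [← Matrix.star_eq_conjTranspose, Matrix.mem_unitaryGroup_iff'.mp hV, one_mul]
    have h2 : Vᴴ * V * W =
        Wᴴ * W * W + t • (Wᴴ * W) + star t • (W * W) + (star t * t) • W := by
      rw [hVW, Matrix.conjTranspose_add, Matrix.conjTranspose_smul, Matrix.conjTranspose_one]
      simp only [add_mul, mul_add, Matrix.smul_mul, Matrix.mul_smul, one_mul, mul_one, smul_smul]
      rw [mul_comm t (star t)]
      abel
    have h3 := congrArg Matrix.trace (h2.symm.trans h1)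
    rw [Matrix.trace_add, Matrix.trace_add, Matrix.trace_add, Matrix.trace_smul, Matrix.trace_smul,
      Matrix.trace_smul, hW1, hW2, hN, smul_zero, smul_zero, add_zero, add_zero, smul_eq_mul] at h3
    linear_combination h3
  have hbound : ‖(Wᴴ * W * W).trace‖ ≤ d * δ * N := by
    have h1 : (Wᴴ * W * W).trace = ∑ i, ∑ j, ∑ k, star (W k i) * W k j * W j i := by
      simp only [Matrix.trace, Matrix.diag, Matrix.mul_apply, Matrix.conjTranspose_apply,
        Finset.sum_mul]
    have hterm : ∀ i j k, ‖star (W k i) * W k j * W j i‖ ≤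
        (δ / 2) * ‖W k i‖ ^ 2 + (δ / 2) * ‖W k j‖ ^ 2 := by
      intro i j k
      rw [norm_mul, norm_mul, norm_star]
      have h2 := mul_le_mul_of_nonneg_left (hδ j i)
        (mul_nonneg (norm_nonneg (W k i)) (norm_nonneg (W k j)))
      have hδ0 : 0 ≤ δ := (norm_nonneg _).trans (hδ j i)
      nlinarith [mul_nonneg hδ0 (sq_nonneg (‖W k i‖ - ‖W k j‖))]
    calc ‖(Wᴴ * W * W).trace‖
        ≤ ∑ i, ∑ j, ∑ k, ((δ / 2) * ‖W k i‖ ^ 2 + (δ / 2) * ‖W k j‖ ^ 2) := by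
          rw [h1]
          refine (norm_sum_le _ _).trans (Finset.sum_le_sum fun i _ => ?_)
          refine (norm_sum_le _ _).trans (Finset.sum_le_sum fun j _ => ?_)
          exact (norm_sum_le _ _).trans (Finset.sum_le_sum fun k _ => hterm i j k)
      _ = d * δ * N := by
          simp only [Finset.sum_add_distrib, ← Finset.mul_sum, Finset.sum_const, Finset.card_univ,
            Fintype.card_fin, nsmul_eq_mul]
          have hN' : ∑ i, ∑ k, ‖W k i‖ ^ 2 = N := Finset.sum_comm
          rw [hN']
          ring
  have hN0 : 0 ≤ N := Finset.sum_nonneg fun i _ => Finset.sum_nonneg fun j _ => sq_nonneg _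
  have hNz : N = 0 := by
    rw [hcubic, norm_mul, norm_neg, Complex.norm_of_nonneg hN0] at hbound
    nlinarith
  have hWz : W = 0 := by
    ext i j
    have h1 := (Finset.sum_eq_zero_iff_of_nonneg
      (fun i _ => Finset.sum_nonneg fun j _ => sq_nonneg ‖W i j‖)).mp hNz i (Finset.mem_univ i)
    have h2 := (Finset.sum_eq_zero_iff_of_nonneg (fun j _ => sq_nonneg ‖W i j‖)).mp h1 j
      (Finset.mem_univ j)
    simpa using h2
  rw [hVW, hWz, zero_add]

lemma tensorRep_apply (g : G) (x y : Conf d n) :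
    (tensorRep u n g : Op d n) x y = ∏ i, (u g : Matrix (Fin d) (Fin d) ℂ) (x i) (y i) := rfl

lemma trace_tensorRep (g : G) :
    (tensorRep u n g : Op d n).trace = (u g : Matrix (Fin d) (Fin d) ℂ).trace ^ n := by
  have : (u g : Matrix (Fin d) (Fin d) ℂ).trace ^ n =
      ∏ _i : Fin n, ∑ a, (u g : Matrix (Fin d) (Fin d) ℂ) a a := by
    rw [Finset.prod_const, Finset.card_univ, Fintype.card_fin]; rfl
  rw [this, Fintype.prod_sum]
  rfl

lemma trace_swap_mul_tensorRep (g : G) :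
    (permMat (Equiv.swap 0 1) * (tensorRep u 2 g : Op d 2)).trace =
      ((u g : Matrix (Fin d) (Fin d) ℂ) * u g).trace := by
  rw [permMat_mul]
  simp only [Matrix.trace, Matrix.diag, Matrix.mul_apply]
  rw [← (finTwoArrowEquiv (Fin d)).symm.sum_comp, Fintype.sum_prod_type]
  refine Finset.sum_congr rfl fun a _ => Finset.sum_congr rfl fun b _ => ?_
  rw [Matrix.submatrix_apply, tensorRep_apply, Fin.prod_univ_two]
  simp [finTwoArrowEquiv, mul_comm]

/-- The functions `Tr(u)^i Tr(u²)^j` are the functions `Tr (A U(·))` of products of swaps. -/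
lemma exists_isInvariant_trace_eq {i j n : ℕ} (h : i + 2 * j = n) :
    ∃ A : Op d n, IsInvariant u A ∧ ∀ g, (A * (tensorRep u n g : Op d n)).trace =
      (u g : Matrix (Fin d) (Fin d) ℂ).trace ^ i *
        ((u g : Matrix (Fin d) (Fin d) ℂ) * u g).trace ^ j := by
  induction j generalizing n with
  | zero =>
    obtain rfl : i = n := h
    exact ⟨1, isInvariant_one, fun g => by rw [one_mul, trace_tensorRep, pow_zero, mul_one]⟩
  | succ j ih =>
    obtain ⟨n, rfl⟩ : ∃ n', n = n' + 2 := ⟨i + 2 * j, by omega⟩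
    obtain ⟨A, hA, hAg⟩ := ih (n := n) (by omega)
    refine ⟨tens A (permMat (Equiv.swap 0 1)), hA.tens (isInvariant_permMat _), fun g => ?_⟩
    rw [pow_succ, ← mul_assoc, ← hAg g, ← trace_swap_mul_tensorRep, trace_tens_mul_tensorRep]

variable [TopologicalSpace G] [IsTopologicalGroup G] [ConnectedSpace G]

lemma exists_eq_smul_one_of_eventually (hu : Continuous u) (hd : d ≠ 0)
    (h : ∀ᶠ g in nhds (1 : G), d * ((u g : Matrix (Fin d) (Fin d) ℂ) * u g).trace =
      (u g : Matrix (Fin d) (Fin d) ℂ).trace ^ 2) (g : G) :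
    ∃ c : ℂ, (u g : Matrix (Fin d) (Fin d) ℂ) = c • 1 := by
  have hd' : (d : ℂ) ≠ 0 := Nat.cast_ne_zero.mpr hd
  have hd'' : (0 : ℝ) < d := Nat.cast_pos.mpr (Nat.pos_of_ne_zero hd)
  let H : Subgroup G :=
    { carrier := {g | ∃ c : ℂ, (u g : Matrix (Fin d) (Fin d) ℂ) = c • 1}
      one_mem' := ⟨1, by simp⟩
      mul_mem' := by
        rintro a b ⟨c, hc⟩ ⟨c', hc'⟩
        exact ⟨c * c', by rw [map_mul, Submonoid.coe_mul, hc, hc']; simp [smul_smul, mul_comm]⟩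
      inv_mem' := by
        rintro a ⟨c, hc⟩
        refine ⟨star c, ?_⟩
        have : ((u a⁻¹ : Matrix.unitaryGroup (Fin d) ℂ) : Matrix (Fin d) (Fin d) ℂ) =
            star (u a : Matrix (Fin d) (Fin d) ℂ) := by rw [map_inv]; rfl
        rw [this, hc, Matrix.star_eq_conjTranspose, Matrix.conjTranspose_smul,
          Matrix.conjTranspose_one] }
  have hH : H = ⊤ := by
    apply subgroup_eq_top_of_eventually
    have huc : Continuous fun g => (u g : Matrix (Fin d) (Fin d) ℂ) :=
      continuous_subtype_val.comp hu
    let t : G → ℂ := fun g => (u g : Matrix (Fin d) (Fin d) ℂ).trace / d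
    have htc : Continuous t := huc.matrix_trace.div_const _
    have ht1 : t 1 = 1 := by
      simp only [t, map_one, Submonoid.coe_one, Matrix.trace_one, Fintype.card_fin]
      exact div_self hd'
    have hnorm : ∀ᶠ g in nhds (1 : G), (1 / 2 : ℝ) < ‖t g‖ :=
      htc.norm.continuousAt.eventually_const_lt (by
        change (1 / 2 : ℝ) < ‖t 1‖
        rw [ht1]; norm_num)
    have hentry : ∀ᶠ g in nhds (1 : G), ∀ i j,
        ‖((u g : Matrix (Fin d) (Fin d) ℂ) - t g • 1) i j‖ < 1 / (2 * d) := by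
      rw [Filter.eventually_all]; intro i
      rw [Filter.eventually_all]; intro j
      have hc : Continuous fun g => ‖((u g : Matrix (Fin d) (Fin d) ℂ) - t g • 1) i j‖ :=
        ((huc.sub (htc.smul continuous_const)).matrix_elem i j).norm
      refine hc.continuousAt.eventually_lt_const ?_
      change ‖((u 1 : Matrix (Fin d) (Fin d) ℂ) - t 1 • 1) i j‖ < 1 / (2 * d)
      rw [ht1, map_one, Submonoid.coe_one, one_smul, sub_self]
      simpa using hd''
    filter_upwards [h, hnorm, hentry] with g h1 h2 h3
    refine ⟨t g, eq_smul_one_of_trace_sq (u g).2 ?_ ?_ (fun i j => (h3 i j).le) ?_⟩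
    · simp only [t]; field_simp
    · simp only [t]; field_simp; linear_combination h1
    · have : (d : ℝ) * (1 / (2 * d)) = 1 / 2 := by field_simp
      rw [this]; exact h2
  exact (hH ▸ Subgroup.mem_top g : g ∈ H)

/-- For a connected group acting by non-scalar operators, the number of charges grows at least
linearly: the functions `Tr(u)^(n-2j) Tr(u²)^j` are linearly independent, because
`Tr(u²) / Tr(u)²` takes infinitely many values near the identity. -/
theorem half_lt_numIrreps (hu : Continuous u)
    (hns : ∃ g, ∀ c : ℂ, (u g : Matrix (Fin d) (Fin d) ℂ) ≠ c • (1 : Matrix (Fin d) (Fin d) ℂ))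
    (n : ℕ) : n / 2 < numIrreps u n := by
  obtain ⟨g₀, hg₀⟩ := hns
  have hd : d ≠ 0 := by
    rintro rfl
    exact hg₀ 0 (Subsingleton.elim _ _)
  have hd' : (d : ℂ) ≠ 0 := Nat.cast_ne_zero.mpr hd
  let t : G → ℂ := fun g => (u g : Matrix (Fin d) (Fin d) ℂ).trace
  let s : G → ℂ := fun g => ((u g : Matrix (Fin d) (Fin d) ℂ) * u g).trace
  have hA : ∀ j : Fin (n / 2 + 1), ∃ A : Op d n, IsInvariant u A ∧
      ∀ g, (A * (tensorRep u n g : Op d n)).trace = t g ^ (n - 2 * j) * s g ^ (j : ℕ) := by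
    exact fun j => exists_isInvariant_trace_eq (by omega)
  choose A hAinv hAtr using hA
  have hli : LinearIndependent ℂ fun j => chargeVector u n (A j) := by
    rw [Fintype.linearIndependent_iff]
    intro c hc
    have hrel : ∀ g, ∑ j : Fin (n / 2 + 1), c j * (t g ^ (n - 2 * j) * s g ^ (j : ℕ)) = 0 := by
      intro g
      have h1 := trace_mul_tensorRep_eq_zero (A := ∑ j, c j • A j)
        (isInvariant_sum _ _ fun j _ => (hAinv j).smul _) (by
          rw [map_sum, ← hc]
          exact Finset.sum_congr rfl fun j _ => map_smul _ _ _) g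
      rw [Finset.sum_mul, Matrix.trace_sum] at h1
      rw [← h1]
      refine Finset.sum_congr rfl fun j _ => ?_
      rw [smul_mul_assoc, Matrix.trace_smul, hAtr, smul_eq_mul]
    by_contra! hne
    obtain ⟨j₀, hj₀⟩ := hne
    let p : Polynomial ℂ := ∑ j : Fin (n / 2 + 1), Polynomial.C (c j) * Polynomial.X ^ (j : ℕ)
    have hp : p ≠ 0 := by
      intro h0
      apply hj₀
      have := congrArg (fun q => q.coeff (j₀ : ℕ)) h0
      simp only [p, Polynomial.finsetSum_coeff, Polynomial.coeff_C_mul_X_pow,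
        Polynomial.coeff_zero] at this
      rwa [Finset.sum_eq_single j₀ (fun j _ hj => if_neg fun h => hj (Fin.ext h.symm)) (by simp),
        if_pos rfl] at this
    have huc : Continuous fun g => (u g : Matrix (Fin d) (Fin d) ℂ) :=
      continuous_subtype_val.comp hu
    have htc : Continuous t := huc.matrix_trace
    have hsc : Continuous s := (huc.matrix_mul huc).matrix_trace
    have ht1 : t 1 = d := by simp [t]
    have hs1 : s 1 = d := by simp [s]
    have ht0 : ∀ᶠ g in nhds (1 : G), t g ≠ 0 :=
      htc.continuousAt.eventually_ne (by rw [ht1]; exact hd')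
    -- near the identity, the ratio `s / t²` is a root of `p`, hence locally constant
    have hroot : ∀ᶠ g in nhds (1 : G), p.eval (s g / t g ^ 2) = 0 := by
      filter_upwards [ht0] with g hg
      have h1 : t g ^ n * p.eval (s g / t g ^ 2) = 0 := by
        rw [← hrel g, Polynomial.eval_finsetSum, Finset.mul_sum]
        refine Finset.sum_congr rfl fun j _ => ?_
        have hj : t g ^ n = t g ^ (n - 2 * (j : ℕ)) * t g ^ (2 * (j : ℕ)) := by
          rw [← pow_add]
          congr 1
          omega
        rw [Polynomial.eval_mul, Polynomial.eval_C, Polynomial.eval_pow, Polynomial.eval_X,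
          div_pow, ← pow_mul, hj]
        field_simp
      exact (mul_eq_zero.mp h1).resolve_left (pow_ne_zero _ hg)
    have hfc : ContinuousAt (fun g => s g / t g ^ 2) 1 :=
      hsc.continuousAt.div (htc.pow 2).continuousAt (by rw [ht1]; exact pow_ne_zero _ hd')
    have hconst : ∀ᶠ g in nhds (1 : G), s g / t g ^ 2 = s 1 / t 1 ^ 2 := by
      have hfin : ((p.roots.toFinset.erase (s 1 / t 1 ^ 2) : Finset ℂ) : Set ℂ).Finite :=
        Finset.finite_toSet _
      have hev := hfc.eventually_mem (hfin.isClosed.isOpen_compl.mem_nhds (by simp))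
      filter_upwards [hev, hroot] with g h1 h2
      by_contra hne
      exact h1 (by simp [hne, hp, Polynomial.IsRoot, h2])
    refine absurd (exists_eq_smul_one_of_eventually hu hd ?_ g₀) (by push Not; exact hg₀)
    filter_upwards [hconst, ht0] with g h1 h2
    rw [ht1, hs1, div_eq_div_iff (pow_ne_zero _ h2) (pow_ne_zero _ hd')] at h1
    have h3 : (d : ℂ) * (d * s g - t g ^ 2) = 0 := by linear_combination h1
    exact sub_eq_zero.mp ((mul_eq_zero.mp h3).resolve_left hd')
  have hcard := hli.fintype_card_le_finrank
  rw [Fintype.card_fin, Module.finrank_fintype_fun_eq_card, ← numIrreps_eq_card] at hcard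
  omega

/-- Symmetric gates on a fixed number of sites are not universal on many sites. -/
theorem tendsto_numIrreps_and_not_universal (hu : Continuous u)
    (hns : ∃ g, ∀ c : ℂ, (u g : Matrix (Fin d) (Fin d) ℂ) ≠ c • (1 : Matrix (Fin d) (Fin d) ℂ)) :
    Filter.Tendsto (fun n => numIrreps u n) Filter.atTop Filter.atTop ∧
      ∀ k : ℕ, ∃ N : ℕ, ∀ n ≥ N,
        localSymmetricUnitaries u n k ≠ symmetricUnitaries u n := by
  have hlt := half_lt_numIrreps hu hns
  refine ⟨Filter.tendsto_atTop_mono (fun n => (hlt n).le) ?_, fun k => ?_⟩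
  · exact Filter.tendsto_atTop.mpr fun b => by
      filter_upwards [Filter.eventually_ge_atTop (2 * b)] with n hn
      omega
  · -- for such `n`, there are more than `n / 2 ≥ |Irreps_G(k)|` charges
    refine ⟨2 * numIrreps u k + k, fun n hn h => ?_⟩
    have h1 := groupDim_sub_ge (u := u) (n := n) (k := k) (l := n) (by omega) le_rfl
      localSymmetricUnitaries_le_symmetricUnitaries localSymmetricUnitaries_le_symmetricUnitaries
    have h2 := finrank_chargeSpace_le (u := u) (n := n) (k := k) (by omega)
    have h3 := hlt n
    rw [finrank_chargeSpace_self, h] at h1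
    omega

end Growth

/-! ### The group `SU(2)` -/

section SpecialUnitary

instance : IsTopologicalGroup (Matrix.specialUnitaryGroup (Fin 2) ℂ) where
  continuous_inv := by
    refine Continuous.subtype_mk ?_ _
    exact continuous_star.comp continuous_subtype_val

/-- The entries `(a, b)` of the first column, which form a point of the sphere `S³`, determine an
element of `SU(2)`. -/
instance : ConnectedSpace (Matrix.specialUnitaryGroup (Fin 2) ℂ) := by
  let S : Set (EuclideanSpace ℂ (Fin 2)) := Metric.sphere 0 1
  have hrank : 1 < Module.rank ℝ (EuclideanSpace ℂ (Fin 2)) := by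
    rw [← Module.finrank_eq_rank, finrank_real_of_complex, finrank_euclideanSpace_fin]
    norm_num
  have hS : IsConnected S := isConnected_sphere hrank 0 zero_le_one
  have : ConnectedSpace S := isConnected_iff_connectedSpace.mp hS
  have hnorm : ∀ v : S, v.1 0 * star (v.1 0) + v.1 1 * star (v.1 1) = 1 := by
    intro v
    have h1 : ‖v.1‖ ^ 2 = 1 := by rw [mem_sphere_zero_iff_norm.mp v.2, one_pow]
    rw [EuclideanSpace.norm_sq_eq, Fin.sum_univ_two] at h1
    simp only [RCLike.star_def, Complex.mul_conj']
    exact_mod_cast h1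
  let f : S → Matrix.specialUnitaryGroup (Fin 2) ℂ := fun v =>
    ⟨!![v.1 0, -star (v.1 1); v.1 1, star (v.1 0)], by
      rw [Matrix.mem_specialUnitaryGroup_iff, Matrix.mem_unitaryGroup_iff']
      have h1 := hnorm v
      simp only [RCLike.star_def] at h1
      refine ⟨?_, ?_⟩
      · ext i j
        fin_cases i <;> fin_cases j <;>
          simp [Matrix.mul_apply, Matrix.star_apply, Fin.sum_univ_two]
        · linear_combination h1
        · ring
        · ring
        · linear_combination h1
      · rw [Matrix.det_fin_two_of, ← h1]
        simp only [RCLike.star_def]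
        ring⟩
  have hf : Continuous f := by
    refine Continuous.subtype_mk (continuous_matrix fun i j => ?_) _
    fin_cases i <;> fin_cases j <;> simp <;> fun_prop
  have hsurj : Function.Surjective f := by
    rintro ⟨V, hV⟩
    obtain ⟨hU, hdet⟩ := Matrix.mem_specialUnitaryGroup_iff.mp hV
    have hadj : star V = V.adjugate := by
      calc star V = star V * (V * V.adjugate) := by
            rw [Matrix.mul_adjugate, hdet, one_smul, mul_one]
        _ = V.adjugate := by
            rw [← mul_assoc, Matrix.mem_unitaryGroup_iff'.mp hU, one_mul]
    rw [Matrix.adjugate_fin_two] at hadj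
    have h11 : V 1 1 = star (V 0 0) := by
      have := congrFun (congrFun hadj 0) 0
      simpa [Matrix.star_apply] using this.symm
    have h01 : V 0 1 = -star (V 1 0) := by
      have := congrFun (congrFun hadj 0) 1
      rw [Matrix.star_apply] at this
      simp [this]
    have hdet' := hdet
    rw [Matrix.det_fin_two, h11, h01] at hdet'
    refine ⟨⟨WithLp.toLp 2 ![V 0 0, V 1 0], ?_⟩, ?_⟩
    · rw [mem_sphere_zero_iff_norm, ← sq_eq_sq₀ (norm_nonneg _) zero_le_one, one_pow,
        EuclideanSpace.norm_sq_eq, Fin.sum_univ_two]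
      have h2 : (‖V 0 0‖ ^ 2 + ‖V 1 0‖ ^ 2 : ℂ) = 1 := by
        rw [← Complex.mul_conj', ← Complex.mul_conj', ← hdet', RCLike.star_def]
        ring
      exact_mod_cast h2
    · apply Subtype.ext
      ext i j
      fin_cases i <;> fin_cases j <;> simp [f, h11, h01]
  exact hsurj.connectedSpace hf

end SpecialUnitary

end

end LSQC

end

theorem mainTheorem1 :
    -- an arbitrary symmetry group
    (∀ (G : Type*) [Group G] (d : ℕ) (u : G →* Matrix.unitaryGroup (Fin d) ℂ)
      (n k : ℕ), k ≤ n →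
      (LSQC.chargeSpace u n k : Set (LSQC.Irreps u n → ℂ)) =
        {χ | ∃ H : LSQC.Op d n, H.IsHermitian ∧
          (∀ t : ℝ, ∃ V ∈ LSQC.localSymmetricUnitaries u n k,
            (V : LSQC.Op d n) = NormedSpace.exp ((-(Complex.I * (t : ℂ))) • H)) ∧
          LSQC.chargeVector u n H = χ} ∧
      (Module.finrank ℝ (LSQC.localLieAlgebra u n n) : ℤ)
          - Module.finrank ℝ (LSQC.localLieAlgebra u n k) ≥
        (Module.finrank ℝ (LSQC.chargeSpace u n n) : ℤ)
          - Module.finrank ℝ (LSQC.chargeSpace u n k) ∧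
      (Module.finrank ℝ (LSQC.chargeSpace u n n) : ℤ)
          - Module.finrank ℝ (LSQC.chargeSpace u n k) ≥
        (LSQC.numIrreps u n : ℤ) - LSQC.numIrreps u k ∧
      (LSQC.groupDim (LSQC.symmetricUnitaries u n) : ℤ)
          - LSQC.groupDim (LSQC.localSymmetricUnitaries u n k) ≥
        (LSQC.numIrreps u n : ℤ) - LSQC.numIrreps u k) ∧
    -- a connected Lie group
    (∀ (E : Type*) [NormedAddCommGroup E] [NormedSpace ℝ E] [FiniteDimensional ℝ E]
      (M : Type*) [TopologicalSpace M] (I : ModelWithCorners ℝ E M)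
      (G : Type*) [Group G] [TopologicalSpace G] [ChartedSpace M G] [LieGroup I ∞ G]
      [ConnectedSpace G]
      (d : ℕ) (u : G →* Matrix.unitaryGroup (Fin d) ℂ), Continuous u →
      ∀ n k l : ℕ, 1 ≤ k → k ≤ l → l ≤ n →
      (Module.finrank ℝ (LSQC.localLieAlgebra u n l) : ℤ)
          - Module.finrank ℝ (LSQC.localLieAlgebra u n k) ≥
        (Module.finrank ℝ (LSQC.chargeSpace u n l) : ℤ)
          - Module.finrank ℝ (LSQC.chargeSpace u n k) ∧
      (Module.finrank ℝ (LSQC.chargeSpace u n l) : ℤ)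
          - Module.finrank ℝ (LSQC.chargeSpace u n k) =
        (LSQC.numIrreps u l : ℤ) - LSQC.numIrreps u k ∧
      (LSQC.groupDim (LSQC.localSymmetricUnitaries u n l) : ℤ)
          - LSQC.groupDim (LSQC.localSymmetricUnitaries u n k) ≥
        (LSQC.numIrreps u l : ℤ) - LSQC.numIrreps u k) ∧
    -- `U(1)`
    (∀ (d : ℕ) (u : Circle →* Matrix.unitaryGroup (Fin d) ℂ), Continuous u →
      (∃ g, ∀ c : ℂ, (u g : Matrix (Fin d) (Fin d) ℂ) ≠ c • (1 : Matrix (Fin d) (Fin d) ℂ)) →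
      Filter.Tendsto (fun n => LSQC.numIrreps u n) Filter.atTop Filter.atTop ∧
      ∀ k : ℕ, ∃ N : ℕ, ∀ n ≥ N,
        LSQC.localSymmetricUnitaries u n k ≠ LSQC.symmetricUnitaries u n) ∧
    -- `SU(2)`
    (∀ (d : ℕ) (u : Matrix.specialUnitaryGroup (Fin 2) ℂ →* Matrix.unitaryGroup (Fin d) ℂ),
      Continuous u →
      (∃ g, ∀ c : ℂ, (u g : Matrix (Fin d) (Fin d) ℂ) ≠ c • (1 : Matrix (Fin d) (Fin d) ℂ)) →
      Filter.Tendsto (fun n => LSQC.numIrreps u n) Filter.atTop Filter.atTop ∧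
      ∀ k : ℕ, ∃ N : ℕ, ∀ n ≥ N,
        LSQC.localSymmetricUnitaries u n k ≠ LSQC.symmetricUnitaries u n) := by
  refine ⟨fun G _ d u n k hk => ?_, fun E _ _ _ M _ I G _ _ _ _ _ d u hu n k l hk hkl hl => ?_,
    fun d u hu hns => LSQC.tendsto_numIrreps_and_not_universal hu hns,
    fun d u hu hns => LSQC.tendsto_numIrreps_and_not_universal hu hns⟩
  · have h1 := LSQC.finrank_chargeSpace_self (u := u) (n := n)
    have h2 := LSQC.finrank_chargeSpace_le (u := u) hk
    have h3 := LSQC.groupDim_sub_ge (u := u) hk le_rfl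
      LSQC.localSymmetricUnitaries_le_symmetricUnitaries
      LSQC.localSymmetricUnitaries_le_symmetricUnitaries
    exact ⟨LSQC.coe_chargeSpace_eq hk, LSQC.finrank_localLieAlgebra_sub hk, by omega, by omega⟩
  · have := topologicalGroup_of_lieGroup I ∞ (G := G)
    have h1 := LSQC.finrank_chargeSpace_eq (n := n) hu hk (hkl.trans hl)
    have h2 := LSQC.finrank_chargeSpace_eq (n := n) hu (hk.trans hkl) hl
    have h3 := LSQC.groupDim_sub_ge (u := u) (hkl.trans hl) hl
      (LSQC.localSymmetricUnitaries_mono hkl) le_rfl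
    exact ⟨LSQC.finrank_localLieAlgebra_sub hkl, by omega, by omega⟩
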